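/- Let $F_1,F_2$ be probability distributions on $\mathbb{R}$ with means $\mu_1,\mu_2$ and variances $\sigma_1^2,\sigma_2^2$, and let $K$ be a constant. For each $n$ let $m=m(n)\ge 2$, let $V_1,\dots,V_m$ be a partition of $[n]$ into $m$ (possibly empty) parts, put $\nu_i=\nu_i(n)=|V_i|/n$, and let $\mathbf{X}_{n,m}=(x_{ij})$ be a random symmetric $n\times n$ matrix whose entries $x_{ij}$, $i\le j$, are independent, satisfy $|x_{ij}|\le K$ almost surely, and have distribution $F_1$ if $i,j$ lie in the same part and $F_2$ if they lie in different parts. Let $\mathbf{J}_n$ be the all-ones matrix, let $\mathbf{I}_{n,m}$ be the $0/1$ matrix whose $(p,q)$ entry is $1$ exactly when $p,q$ lie in the same part, and let $$\overline{\mathbf{X}}_{n,m}=\mathbf{X}_{n,m}-\mu_1\mathbf{I}_{n,m}-\mu_2(\mathbf{J}_n-\mathbf{I}_{n,m}).$$ For a real symmetric $n\times n$ matrix $\mathbf{M}$ with eigenvalues $\lambda_1,\dots,\lambda_n$ (with multiplicity), let $\Phi_{\mathbf{M}}$ be its empirical spectral distribution, $\Phi_{\mathbf{M}}(x)=\frac1n\#\{i:\lambda_i\le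 x\}$. For $v>0$ the semicircle law of variance $v$ is the distribution with density $\frac{1}{2\pi v}\sqrt{4v-x^2}\,\mathbf{1}_{|x|\le 2\sqrt v}$; for $v=0$ it is the point mass at $0$. Random distributions $L_n$ converge weakly in probability to $L$ if $\int f\,dL_n\to\int f\,dL$ in probability for every bounded continuous $f:\mathbb{R}\to\mathbb{R}$. (i) Suppose that $\lim_{n\to\infty}\max_i\nu_i(n)$ exists and is positive and that $\nu_i(n)/\nu_j(n)\to 1$ as $n\to\infty$, uniformly in $1\le i,j\le m(n)$ (uniformity is automatic if $m$ does not depend on $n$). Then $m(n)$ equals a constant $m$ for all large $n$, and $\Phi_{n^{-1/2}\overline{\mathbf{X}}_{n,m}}$ converges weakly in probability, as $n\to\infty$, to the semicircle law of variance $\Delta^2=(\sigma_1^2+(m-1)\sigma_2^2)/m$. (ii) Suppose that $\lim_{n\to\infty}\max_i\nu_i(n)=0$. Then $\Phi_{n^{-1/2}\overline{\mathbf{X}}_{n,m}}$ converges weakly in probability, as $n\to\infty$, to the semicircle law of variance $\sigma_2^2$. -/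

import Mathlib

open MeasureTheory ProbabilityTheory Filter Topology
open scoped BoundedContinuousFunction

namespace RandomMultipartite

/-- The proportion `ν_k = |V_k| / n` of the part `V_k = κ⁻¹(k)`, where the parts of the vertex
set `Fin n` are given by the colouring `κ`. -/
noncomputable def proportion {n m : ℕ} (κ : Fin n → Fin m) (k : Fin m) : ℝ :=
  ((Finset.univ.filter fun i => κ i = k).card : ℝ) / (n : ℝ)

/-- The largest proportion `max {ν_1, …, ν_m}`. -/
noncomputable def maxProportion {n m : ℕ} (κ : Fin n → Fin m) : ℝ :=
  ⨆ k, proportion κ k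

/-- The part sizes are asymptotically equal with positive maximum proportion:
`lim max {ν_1(n), …, ν_m(n)} > 0` and `lim ν_k(n) / ν_l(n) = 1`, uniformly in the parts `k, l`
(uniformity is automatic if `m(n)` does not depend on `n`). -/
def AsymptoticallyBalanced {m : ℕ → ℕ} (κ : ∀ n, Fin n → Fin (m n)) : Prop :=
  (∃ L : ℝ, 0 < L ∧ Tendsto (fun n => maxProportion (κ n)) atTop (𝓝 L)) ∧
  ∀ ε : ℝ, 0 < ε → ∀ᶠ n in atTop, ∀ k l : Fin (m n),
    |proportion (κ n) k / proportion (κ n) l - 1| < ε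

/-- All part proportions tend to zero: `lim max {ν_1(n), …, ν_m(n)} = 0`. -/
def AsymptoticallyNegligible {m : ℕ → ℕ} (κ : ∀ n, Fin n → Fin (m n)) : Prop :=
  Tendsto (fun n => maxProportion (κ n)) atTop (𝓝 0)

/-- `X` is a random multipartite matrix with parts given by `κ`: a symmetric random matrix with
independent entries on and above the diagonal, the entries within a part having law `F₁`, those
across two different parts having law `F₂`, all of them bounded by `K`. -/
structure IsRandomMultipartiteMatrix {Ω : Type*} [MeasurableSpace Ω] (P : Measure Ω) {n m : ℕ}
    (κ : Fin n → Fin m) (F₁ F₂ : Measure ℝ) (K : ℝ)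
    (X : Ω → Matrix (Fin n) (Fin n) ℝ) : Prop where
  symm : ∀ ω i j, X ω i j = X ω j i
  measurable : ∀ i j, Measurable fun ω => X ω i j
  indep : iIndepFun
    (fun (p : {p : Fin n × Fin n // p.1 ≤ p.2}) (ω : Ω) => X ω p.1.1 p.1.2) P
  law_within : ∀ i j, κ i = κ j → P.map (fun ω => X ω i j) = F₁
  law_across : ∀ i j, κ i ≠ κ j → P.map (fun ω => X ω i j) = F₂
  bounded : ∀ i j, ∀ᵐ ω ∂P, |X ω i j| ≤ K

/-- The quasi-unit matrix `I_{n,m}`. -/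
def quasiUnit {n m : ℕ} (κ : Fin n → Fin m) : Matrix (Fin n) (Fin n) ℝ :=
  Matrix.of fun p q => if κ p = κ q then 1 else 0

/-- The all-ones matrix `J_n`. -/
def allOnes (n : ℕ) : Matrix (Fin n) (Fin n) ℝ := Matrix.of fun _ _ => 1

/-- The centred matrix `X - μ₁ I_{n,m} - μ₂ (J_n - I_{n,m})`, where `μ₁, μ₂` are the means of
`F₁, F₂`. -/
noncomputable def centred {n m : ℕ} (κ : Fin n → Fin m) (F₁ F₂ : Measure ℝ)
    (A : Matrix (Fin n) (Fin n) ℝ) : Matrix (Fin n) (Fin n) ℝ :=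
  A - (∫ x, x ∂F₁) • quasiUnit κ - (∫ x, x ∂F₂) • (allOnes n - quasiUnit κ)

/-- The rescaled centred matrix `n^{-1/2} (X - μ₁ I_{n,m} - μ₂ (J_n - I_{n,m}))`. -/
noncomputable def rescaledCentred {n m : ℕ} (κ : Fin n → Fin m) (F₁ F₂ : Measure ℝ)
    (A : Matrix (Fin n) (Fin n) ℝ) : Matrix (Fin n) (Fin n) ℝ :=
  (√(n : ℝ))⁻¹ • centred κ F₁ F₂ A

theorem IsRandomMultipartiteMatrix.isHermitian_rescaledCentred {Ω : Type*} [MeasurableSpace Ω]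
    {P : Measure Ω} {n m : ℕ} {κ : Fin n → Fin m} {F₁ F₂ : Measure ℝ} {K : ℝ}
    {X : Ω → Matrix (Fin n) (Fin n) ℝ} (hX : IsRandomMultipartiteMatrix P κ F₁ F₂ K X) (ω : Ω) :
    (rescaledCentred κ F₁ F₂ (X ω)).IsHermitian := by
  ext i j
  simp [rescaledCentred, centred, quasiUnit, allOnes, hX.symm ω j i, eq_comm (a := κ j)]

/-- The empirical spectral distribution of a real symmetric `n × n` matrix, as a measure on `ℝ`:
mass `1 / n` at each eigenvalue, with multiplicity. -/
noncomputable def esd {n : ℕ} {A : Matrix (Fin n) (Fin n) ℝ} (hA : A.IsHermitian) : Measure ℝ :=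
  (n : ENNReal)⁻¹ • ∑ i, Measure.dirac (hA.eigenvalues i)

/-- The distribution function of `esd` is `x ↦ (1 / n) #{i | λ_i ≤ x}`. -/
theorem esd_Iic {n : ℕ} {A : Matrix (Fin n) (Fin n) ℝ} (hA : A.IsHermitian) (x : ℝ) :
    (esd hA).real (Set.Iic x) =
      ((Finset.univ.filter fun i => hA.eigenvalues i ≤ x).card : ℝ) / (n : ℝ) := by
  have h : (∑ i, Measure.dirac (hA.eigenvalues i)) (Set.Iic x) =
      ((Finset.univ.filter fun i => hA.eigenvalues i ≤ x).card : ENNReal) := by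
    rw [Measure.finsetSum_apply]
    simp [Set.indicator_apply]
  simp [Measure.real, esd, h, div_eq_inv_mul]

/-- The density of the semicircle law of variance `v > 0`. -/
noncomputable def semicircleDensity (v x : ℝ) : ℝ :=
  if |x| ≤ 2 * √v then 1 / (2 * Real.pi * v) * √(4 * v - x ^ 2) else 0

/-- The centred semicircle law of variance `v ≥ 0`; for `v = 0` it is the point mass at `0`. -/
noncomputable def semicircleLaw (v : ℝ) : Measure ℝ :=
  if v = 0 then Measure.dirac 0
  else volume.withDensity fun x => ENNReal.ofReal (semicircleDensity v x)

/-- The random measures `L n` on `ℝ` converge weakly in probability to the measure `ν`: for each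
bounded continuous `f`, the random variables `∫ f dL_n` converge in probability to `∫ f dν`. -/
def TendstoWeaklyInProbability {Ω : ℕ → Type*} [∀ n, MeasurableSpace (Ω n)]
    (P : ∀ n, Measure (Ω n)) (L : ∀ n, Ω n → Measure ℝ) (ν : Measure ℝ) : Prop :=
  ∀ f : ℝ →ᵇ ℝ, ∀ ε : ℝ, 0 < ε →
    Tendsto (fun n => P n {ω | ε ≤ |(∫ x, f x ∂(L n ω)) - ∫ x, f x ∂ν|}) atTop (𝓝 0)

/-- `Δ² = (σ₁² + (m - 1) σ₂²) / m`, where `σ₁², σ₂²` are the variances of `F₁, F₂`. -/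
noncomputable def deltaSq (F₁ F₂ : Measure ℝ) (m : ℕ) : ℝ :=
  (variance id F₁ + ((m : ℝ) - 1) * variance id F₂) / (m : ℝ)

end RandomMultipartite

/-! The proof follows the Stieltjes transform along the imaginary axis. After centring and scaling
by `n^{-1/2}`, the matrix `A` has independent centred entries of size `O(n^{-1/2})`, and only its
variance profile `s i j` remembers the partition. The `i`-th row of `s` sums to `σ₂² + ν (σ₁² -
σ₂²)`, where `ν` is the proportion of the part containing `i`. In both cases all these sums converge
uniformly to one number `v`: in the balanced case every proportion tends to `1/M`, in the negligible
case to `0`. It is therefore enough to prove a semicircle law for profiles with asymptotically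
constant row sums (`tendstoWeaklyInProbability_semicircleLaw`).

Let `G = (A - iη)⁻¹`. By the Schur complement, `1 / G i i = A i i - iη - Q i`, where `Q i` is a
quadratic form in row `i` whose coefficients come from the matrix with row and column `i` deleted.
These coefficients are independent of row `i`, so a second-moment bound puts `Q i` close to `∑ j, s
i j * G j j`. The transform `m` of the semicircle law satisfies `1 / m = -iη - v m`. Subtracting the
two equations bounds `|G i i - m|` by `η⁻²` times a weighted sum of the `|G j j - m|` plus small
errors. Once `η² ≥ 2 (v + 1)`, summation over `i` makes this a contraction, and the normalised trace
converges to `m` in probability (`norm_trace_resolventMatrix_sub_le`).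

Convergence at `iη` for all large `η` already determines the weak limit. By Stone-Weierstrass the
functions `1 / (x - iη)`, their conjugates and the constants span a dense subspace of the continuous
functions on the compactified line (`submodule_eq_top_of_resolventMap_mem`). Tightness comes from
the limit being a probability measure. -/

namespace RandomMultipartite

/-! ### Calculus of convergence to zero in probability -/

/-- The random vectors `d n` tend to zero in probability. -/
def VanishesInProbability {Ω : ℕ → Type*} [∀ n, MeasurableSpace (Ω n)]
    (P : ∀ n, Measure (Ω n)) {E : Type*} [Norm E] (d : ∀ n, Ω n → E) : Prop :=
  ∀ ε : ℝ, 0 < ε → Tendsto (fun n => P n {ω | ε ≤ ‖d n ω‖}) atTop (𝓝 0)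

namespace VanishesInProbability

variable {Ω : ℕ → Type*} [∀ n, MeasurableSpace (Ω n)] {P : ∀ n, Measure (Ω n)}
  {E F : Type*} [SeminormedAddCommGroup E] [SeminormedAddCommGroup F]

/-- The majorant `e` may depend on `δ`; this leaves room for cut-offs and for splittings such as `y
≤ τ + y² / τ`, whose parameters are tuned to the tolerance. -/
theorem of_forall_approx {d : ∀ n, Ω n → E}
    (h : ∀ δ : ℝ, 0 < δ → ∃ e : ∀ n, Ω n → F, VanishesInProbability P e ∧
      ∀ᶠ n in atTop, ∀ ω, ‖d n ω‖ ≤ ‖e n ω‖ + δ) : VanishesInProbability P d := by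
  intro ε hε
  obtain ⟨e, he, hle⟩ := h (ε / 2) (by positivity)
  refine tendsto_of_tendsto_of_tendsto_of_le_of_le' tendsto_const_nhds (he (ε / 2) (by positivity))
    (Eventually.of_forall fun n => zero_le) ?_
  filter_upwards [hle] with n hn
  refine measure_mono fun ω hω => ?_
  have := hn ω
  simp only [Set.mem_ofPred_eq] at hω ⊢
  linarith

theorem mono {d : ∀ n, Ω n → E} {e : ∀ n, Ω n → F} (he : VanishesInProbability P e)
    (h : ∀ᶠ n in atTop, ∀ ω, ‖d n ω‖ ≤ ‖e n ω‖) : VanishesInProbability P d :=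
  of_forall_approx fun δ hδ => ⟨e, he, h.mono fun n hn ω => (hn ω).trans (by linarith)⟩

theorem add {d e : ∀ n, Ω n → E} (hd : VanishesInProbability P d)
    (he : VanishesInProbability P e) :
    VanishesInProbability P fun n ω => d n ω + e n ω := by
  intro ε hε
  have h := (hd (ε / 2) (by positivity)).add (he (ε / 2) (by positivity))
  rw [add_zero] at h
  refine tendsto_of_tendsto_of_tendsto_of_le_of_le tendsto_const_nhds h (fun n => zero_le) ?_
  intro n
  refine (measure_mono fun ω hω => ?_).trans (measure_union_le _ _)
  simp only [Set.mem_ofPred_eq, Set.mem_union] at hω ⊢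
  have := norm_add_le (d n ω) (e n ω)
  by_contra! hcon
  linarith [hcon.1, hcon.2]

theorem const_mul {d : ∀ n, Ω n → ℂ} (hd : VanishesInProbability P d) (c : ℂ) :
    VanishesInProbability P fun n ω => c * d n ω := by
  intro ε hε
  refine tendsto_of_tendsto_of_tendsto_of_le_of_le tendsto_const_nhds
    (hd (ε / (‖c‖ + 1)) (by positivity)) (fun n => zero_le) ?_
  intro n
  refine measure_mono fun ω hω => ?_
  simp only [Set.mem_ofPred_eq, norm_mul] at hω ⊢
  rw [div_le_iff₀ (by positivity)]
  nlinarith [norm_nonneg (d n ω)]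

end VanishesInProbability

/-! ### Density of the resolvent functions on the compactified line -/

theorem ofReal_sub_I_mul_ne_zero (x : ℝ) {η : ℝ} (hη : 0 < η) : (x : ℂ) - Complex.I * η ≠ 0 := by
  intro h
  have := congrArg Complex.im h
  simp at this
  exact hη.ne' this

/-- The function `x ↦ 1 / (x - i η)` on the real line, extended by `0` at infinity. -/
noncomputable def resolventMap (η : ℝ) (hη : 0 < η) : C(OnePoint ℝ, ℂ) :=
  OnePoint.continuousMapMk ⟨fun x : ℝ => ((x : ℂ) - Complex.I * η)⁻¹,
    Continuous.inv₀ (by fun_prop) fun x => ofReal_sub_I_mul_ne_zero x hη⟩ 0 (by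
      rw [Filter.coclosedCompact_eq_cocompact]
      refine tendsto_inv₀_cobounded.comp ?_
      rw [← tendsto_norm_atTop_iff_cobounded]
      refine tendsto_atTop_mono (f := fun x : ℝ => ‖x‖) (fun x => ?_) tendsto_norm_cocompact_atTop
      simpa using Complex.abs_re_le_norm ((x : ℂ) - Complex.I * η))

@[simp] theorem resolventMap_coe (η : ℝ) (hη : 0 < η) (x : ℝ) :
    resolventMap η hη (x : OnePoint ℝ) = ((x : ℂ) - Complex.I * η)⁻¹ := rfl

@[simp] theorem resolventMap_infty (η : ℝ) (hη : 0 < η) :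
    resolventMap η hη OnePoint.infty = 0 := rfl

theorem norm_inv_ofReal_sub_I_mul_le (x : ℝ) {η : ℝ} (hη : 0 < η) :
    ‖((x : ℂ) - Complex.I * η)⁻¹‖ ≤ η⁻¹ := by
  rw [norm_inv]
  refine inv_anti₀ hη ?_
  have := Complex.abs_im_le_norm ((x : ℂ) - Complex.I * η)
  simpa [abs_of_pos hη] using this

theorem norm_resolventMap_le (η : ℝ) (hη : 0 < η) : ‖resolventMap η hη‖ ≤ η⁻¹ := by
  rw [ContinuousMap.norm_le _ (by positivity)]
  intro x
  induction x using OnePoint.rec with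
  | infty => simp [hη.le]
  | coe x => exact norm_inv_ofReal_sub_I_mul_le x hη

/-- The scalar resolvent identity: it makes products of two different resolvent functions linear
combinations of them, so a mere subspace acquires products. -/
theorem resolventMap_sub (η θ : ℝ) (hη : 0 < η) (hθ : 0 < θ) :
    resolventMap θ hθ - resolventMap η hη =
      (Complex.I * (θ - η)) • (resolventMap η hη * resolventMap θ hθ) := by
  ext x
  induction x using OnePoint.rec with
  | infty => simp
  | coe x =>
    have h1 := ofReal_sub_I_mul_ne_zero x hη
    have h2 := ofReal_sub_I_mul_ne_zero x hθ
    simp only [ContinuousMap.sub_apply, resolventMap_coe, ContinuousMap.smul_apply,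
      ContinuousMap.mul_apply, smul_eq_mul]
    field_simp
    ring

/-- This is the identity behind the unimodularity of the Cayley transform `(x + iη) / (x - iη) = 1 +
2iη / (x - iη)`. -/
theorem star_resolventMap (η : ℝ) (hη : 0 < η) :
    resolventMap η hη - star (resolventMap η hη) =
      (2 * Complex.I * η) • (resolventMap η hη * star (resolventMap η hη)) := by
  ext x
  induction x using OnePoint.rec with
  | infty => simp
  | coe x =>
    have h1 := ofReal_sub_I_mul_ne_zero x hη
    have h2 : (x : ℂ) + Complex.I * η ≠ 0 := by
      intro h
      apply h1
      have := congrArg (starRingEnd ℂ) h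
      simpa [← sub_eq_add_neg] using this
    simp only [ContinuousMap.sub_apply, resolventMap_coe, ContinuousMap.smul_apply,
      ContinuousMap.mul_apply, smul_eq_mul, ContinuousMap.star_apply, star_inv₀, star_sub,
      RCLike.star_def, Complex.conj_ofReal, map_mul, Complex.conj_I, neg_mul, sub_neg_eq_add]
    field_simp
    ring

/-- A closed subspace of the continuous functions on the compactified real line that is closed
under conjugation and contains the constants and the resolvent functions `1 / (x - i η)` for all
large `η` contains all continuous functions. -/
theorem submodule_eq_top_of_resolventMap_mem (S : Submodule ℂ C(OnePoint ℝ, ℂ))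
    (hS : IsClosed (S : Set C(OnePoint ℝ, ℂ))) (hstar : ∀ f ∈ S, star f ∈ S) (h1 : 1 ∈ S)
    (η₀ : ℝ) (hη₀ : 0 < η₀) (hres : ∀ (η : ℝ) (hη : η₀ ≤ η), resolventMap η (hη₀.trans_le hη) ∈ S) :
    S = ⊤ := by
  set r := resolventMap η₀ hη₀ with hr
  -- Both claims go through one induction: `r ^ (k + 1)` is the limit of `r ^ k` times the resolvent
  -- function at `θ`, as `θ` decreases to `η₀`, and the resolvent identity then yields the mixed
  -- product of degree `k + 1`.
  have hmix : ∀ k : ℕ, r ^ k ∈ S ∧ ∀ (θ : ℝ) (hθ : η₀ < θ),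
      r ^ k * resolventMap θ (hη₀.trans hθ) ∈ S := by
    intro k
    induction k with
    | zero => exact ⟨by simpa using h1, fun θ hθ => by simpa using hres θ hθ.le⟩
    | succ k ih =>
      have hk : r ^ (k + 1) ∈ S := by
        have hθ : ∀ t : ℕ, η₀ < η₀ + 1 / ((t : ℝ) + 1) := fun t => by
          have : 0 < 1 / ((t : ℝ) + 1) := by positivity
          linarith
        have hlim : Tendsto (fun t : ℕ =>
            r ^ k * resolventMap (η₀ + 1 / ((t : ℝ) + 1)) (hη₀.trans (hθ t)))
            atTop (𝓝 (r ^ k * r)) := by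
          refine Tendsto.const_mul _ ?_
          rw [tendsto_iff_norm_sub_tendsto_zero]
          refine squeeze_zero (fun _ => norm_nonneg _)
            (g := fun t : ℕ => 1 / ((t : ℝ) + 1) * (η₀⁻¹ * η₀⁻¹)) (fun t => ?_) ?_
          · rw [resolventMap_sub, norm_smul]
            refine mul_le_mul ?_ ?_ (norm_nonneg _) (by positivity)
            · have : (0:ℝ) < (t : ℝ) + 1 := by positivity
              simp only [Complex.ofReal_add, add_sub_cancel_left, norm_mul, Complex.norm_I, one_mul,
                Complex.norm_real, Real.norm_eq_abs]
              rw [abs_of_pos (by positivity)]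
            · refine (norm_mul_le _ _).trans (mul_le_mul (norm_resolventMap_le _ _)
                ((norm_resolventMap_le _ _).trans (inv_anti₀ hη₀ (hθ t).le)) (norm_nonneg _)
                (by positivity))
          · simpa using (tendsto_one_div_add_atTop_nhds_zero_nat (𝕜 := ℝ)).mul_const (η₀⁻¹ * η₀⁻¹)
        rw [pow_succ]
        exact hS.mem_of_tendsto hlim (Eventually.of_forall fun t => ih.2 _ (hθ t))
      refine ⟨hk, fun θ hθ => ?_⟩
      have hne : (Complex.I * ((θ : ℂ) - η₀)) ≠ 0 := by
        refine mul_ne_zero Complex.I_ne_zero ?_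
        rw [← Complex.ofReal_sub, Complex.ofReal_ne_zero]
        linarith
      have heq : r ^ (k + 1) * resolventMap θ (hη₀.trans hθ) = (Complex.I * ((θ : ℂ) - η₀))⁻¹ •
          (r ^ k * resolventMap θ (hη₀.trans hθ) - r ^ (k + 1)) := by
        rw [pow_succ, ← mul_sub, hr, resolventMap_sub, mul_smul_comm, inv_smul_smul₀ hne, mul_assoc]
      rw [heq]
      exact S.smul_mem _ (S.sub_mem (ih.2 θ hθ) hk)
  -- The Cayley transform. Since `star w = w⁻¹`, the star algebra generated by `w` is spanned by the
  -- integer powers of `w`; positive powers are polynomials in `r`, negative ones their conjugates.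
  set w : C(OnePoint ℝ, ℂ) := 1 + (2 * Complex.I * η₀) • r with hw
  have hunit : ∀ (c : ℂ) (g : C(OnePoint ℝ, ℂ)), star c = -c → g - star g = c • (g * star g) →
      (1 + c • g) * star (1 + c • g) = 1 := by
    intro c g hc hg
    have hg' : c • g - c • star g = (c * c) • (g * star g) := by rw [← smul_sub, hg, mul_smul]
    rw [star_add, star_one, star_smul, hc, mul_add, mul_one, add_mul, one_mul,
      smul_mul_smul_comm, mul_neg, neg_smul, neg_smul, ← hg']
    abel
  have hws : w * star w = 1 := hunit _ _ (by simp) (star_resolventMap η₀ hη₀)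
  have hwpow : ∀ k : ℕ, w ^ k ∈ S := by
    intro k
    rw [hw, add_comm, add_pow]
    refine S.sum_mem fun j _ => ?_
    rw [one_pow, mul_one, smul_pow, smul_mul_assoc,
      mul_comm (r ^ j), ← nsmul_eq_mul]
    exact S.smul_mem _ (S.nsmul_mem (hmix j).1 _)
  let u : unitary C(OnePoint ℝ, ℂ) :=
    ⟨w, Unitary.mem_iff.2 ⟨by rw [mul_comm]; exact hws, hws⟩⟩
  have huS : ∀ k : ℤ, ((u ^ k : unitary C(OnePoint ℝ, ℂ)) : C(OnePoint ℝ, ℂ)) ∈ S := by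
    intro k
    obtain ⟨j, rfl | rfl⟩ := k.eq_nat_or_neg
    · simpa [u] using hwpow j
    · rw [zpow_neg, zpow_natCast, ← Unitary.star_eq_inv, Unitary.coe_star]
      exact hstar _ (by simpa [u] using hwpow j)
  set A := StarAlgebra.adjoin ℂ {w} with hA
  have hAS : ∀ f ∈ A, f ∈ S := by
    intro f hf
    have hf' : f ∈ Algebra.adjoin ℂ ({w} ∪ star {w} : Set C(OnePoint ℝ, ℂ)) := by
      rwa [← StarAlgebra.adjoin_toSubalgebra]
    rw [← Subalgebra.mem_toSubmodule, Algebra.adjoin_eq_span] at hf'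
    refine Submodule.span_le.2 ?_ hf'
    intro g hg
    obtain ⟨k, rfl⟩ : ∃ k : ℤ, g = ((u ^ k : unitary C(OnePoint ℝ, ℂ)) : C(OnePoint ℝ, ℂ)) := by
      induction hg using Submonoid.closure_induction with
      | mem x hx =>
        rcases hx with hx | hx
        · exact ⟨1, by simpa [u] using hx⟩
        · refine ⟨-1, ?_⟩
          rw [zpow_neg_one, ← Unitary.star_eq_inv, Unitary.coe_star]
          have : star x = w := by simpa using hx
          simp [u, ← this]
      | one => exact ⟨0, by simp⟩
      | mul x y _ _ hx hy =>
        obtain ⟨a, rfl⟩ := hx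
        obtain ⟨b, rfl⟩ := hy
        exact ⟨a + b, by rw [zpow_add]; rfl⟩
    exact huS k
  have hsep : A.SeparatesPoints := by
    intro x y hxy
    refine ⟨w, ⟨w, StarAlgebra.subset_adjoin ℂ _ rfl, rfl⟩, ?_⟩
    have key : w x = w y ↔ r x = r y := by
      simp [hw, hη₀.ne']
    rw [ne_eq, key]
    induction x using OnePoint.rec with
    | infty =>
      induction y using OnePoint.rec with
      | infty => exact absurd rfl hxy
      | coe y => simpa [hr] using (inv_ne_zero (ofReal_sub_I_mul_ne_zero y hη₀)).symm
    | coe x =>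
      induction y using OnePoint.rec with
      | infty => simpa [hr] using (inv_ne_zero (ofReal_sub_I_mul_ne_zero x hη₀))
      | coe y =>
        intro h
        apply hxy
        simp [hr] at h
        rw [h]
  have htop := ContinuousMap.starSubalgebra_topologicalClosure_eq_top_of_separatesPoints A hsep
  rw [eq_top_iff]
  intro f _
  have hf : f ∈ A.topologicalClosure := by rw [htop]; trivial
  have hf' : f ∈ closure (A : Set C(OnePoint ℝ, ℂ)) := hf
  exact closure_minimal (fun g hg => hAS g hg) hS hf'

/-! ### From Stieltjes transforms to weak convergence in probability -/

section Weak

variable {Ω : ℕ → Type*} [∀ n, MeasurableSpace (Ω n)] {P : ∀ n, Measure (Ω n)}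
  {L : ∀ n, Ω n → Measure ℝ} {ν : Measure ℝ}

theorem integrable_continuousMap_coe (μ : Measure ℝ) [IsFiniteMeasure μ] (f : C(OnePoint ℝ, ℂ)) :
    Integrable (fun x : ℝ => f (x : OnePoint ℝ)) μ :=
  Integrable.of_bound ((f.continuous.comp OnePoint.continuous_coe).aestronglyMeasurable) ‖f‖
    (Eventually.of_forall fun _ => f.norm_coe_le_norm _)

/-- Convergence in probability of the integrals of the resolvent functions `1 / (x - i η)` for all
large `η` gives convergence in probability for all continuous functions on the compactified
real line. -/
theorem vanishesInProbability_of_resolvent [∀ n ω, IsFiniteMeasure (L n ω)]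
    [IsProbabilityMeasure ν] (hL : ∀ᶠ n in atTop, ∀ ω, IsProbabilityMeasure (L n ω))
    (η₀ : ℝ) (hη₀ : 0 < η₀)
    (h : ∀ η : ℝ, η₀ ≤ η → VanishesInProbability P fun n ω =>
      (∫ x : ℝ, ((x : ℂ) - Complex.I * η)⁻¹ ∂(L n ω)) - ∫ x : ℝ, ((x : ℂ) - Complex.I * η)⁻¹ ∂ν)
    (f : C(OnePoint ℝ, ℂ)) :
    VanishesInProbability P fun n ω =>
      (∫ x : ℝ, f (x : OnePoint ℝ) ∂(L n ω)) - ∫ x : ℝ, f (x : OnePoint ℝ) ∂ν := by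
  let S : Submodule ℂ C(OnePoint ℝ, ℂ) :=
    { carrier := {f | VanishesInProbability P fun n ω =>
        (∫ x : ℝ, f (x : OnePoint ℝ) ∂(L n ω)) - ∫ x : ℝ, f (x : OnePoint ℝ) ∂ν}
      zero_mem' := fun ε hε => by simp [hε.not_ge]
      add_mem' := fun {f g} hf hg => by
        refine (VanishesInProbability.add hf hg).mono (Eventually.of_forall fun n ω => le_of_eq ?_)
        simp only [ContinuousMap.add_apply]
        rw [integral_add (integrable_continuousMap_coe _ f) (integrable_continuousMap_coe _ g),
          integral_add (integrable_continuousMap_coe _ f) (integrable_continuousMap_coe _ g)]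
        congr 1
        ring
      smul_mem' := fun c f hf => by
        refine (VanishesInProbability.const_mul hf c).mono
          (Eventually.of_forall fun n ω => le_of_eq ?_)
        simp only [ContinuousMap.smul_apply, smul_eq_mul, integral_const_mul, mul_sub] }
  -- A uniform error `δ / 2` in the test function costs at most `δ / 2` for each of the two
  -- probability measures.
  have hS : IsClosed (S : Set C(OnePoint ℝ, ℂ)) := by
    refine isClosed_of_closure_subset fun f hf => ?_
    refine VanishesInProbability.of_forall_approx (F := ℂ) fun δ hδ => ?_
    obtain ⟨g, hg, hfg⟩ := Metric.mem_closure_iff.1 hf (δ / 2) (by positivity)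
    rw [dist_eq_norm] at hfg
    refine ⟨_, hg, hL.mono fun n hn ω => ?_⟩
    have hbound : ∀ (μ : Measure ℝ) [IsProbabilityMeasure μ],
        ‖(∫ x : ℝ, f (x : OnePoint ℝ) ∂μ) - ∫ x : ℝ, g (x : OnePoint ℝ) ∂μ‖ ≤ δ / 2 := by
      intro μ _
      rw [← integral_sub (integrable_continuousMap_coe _ f) (integrable_continuousMap_coe _ g)]
      refine (norm_integral_le_of_norm_le_const (C := δ / 2)
        (Eventually.of_forall fun _ : ℝ => ?_)).trans (by simp)
      exact ((f - g).norm_coe_le_norm _).trans hfg.le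
    have h1 := @hbound (L n ω) (hn ω)
    have h2 := hbound ν
    set a := ∫ x : ℝ, f (x : OnePoint ℝ) ∂(L n ω)
    set b := ∫ x : ℝ, g (x : OnePoint ℝ) ∂(L n ω)
    set c := ∫ x : ℝ, f (x : OnePoint ℝ) ∂ν
    set d := ∫ x : ℝ, g (x : OnePoint ℝ) ∂ν
    calc ‖a - c‖ = ‖(b - d) + ((a - b) - (c - d))‖ := by congr 1; ring
      _ ≤ ‖b - d‖ + (‖a - b‖ + ‖c - d‖) :=
        (norm_add_le _ _).trans (add_le_add le_rfl (norm_sub_le _ _))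
      _ ≤ ‖b - d‖ + δ := by linarith
  have htop : S = ⊤ := by
    refine submodule_eq_top_of_resolventMap_mem S hS (fun f hf => ?_) ?_ η₀ hη₀
      (fun η hη => h η hη)
    · refine VanishesInProbability.mono (show VanishesInProbability P _ from hf)
        (Eventually.of_forall fun n ω => le_of_eq ?_)
      simp only [ContinuousMap.star_apply, RCLike.star_def, integral_conj]
      rw [← map_sub, RCLike.norm_conj]
    · intro ε hε
      refine tendsto_const_nhds.congr' (hL.mono fun n hn => ?_)
      have := hn
      simp [hε.not_ge]
  have : f ∈ S := by rw [htop]; trivial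
  exact this

/-- The cut-off `R² / (x² + R²)`. -/
noncomputable def cauchyCutoff (R x : ℝ) : ℝ := R ^ 2 / (x ^ 2 + R ^ 2)

theorem cauchyCutoff_nonneg (R x : ℝ) : 0 ≤ cauchyCutoff R x := by
  unfold cauchyCutoff; positivity

theorem cauchyCutoff_le_one (R x : ℝ) : cauchyCutoff R x ≤ 1 :=
  div_le_one_of_le₀ (by nlinarith [sq_nonneg x]) (by positivity)

theorem continuous_cauchyCutoff {R : ℝ} (hR : 0 < R) : Continuous (cauchyCutoff R) :=
  Continuous.div (by fun_prop) (by fun_prop) fun x => by positivity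

theorem tendsto_cauchyCutoff_cocompact {R : ℝ} :
    Tendsto (cauchyCutoff R) (cocompact ℝ) (𝓝 0) := by
  refine Tendsto.div_atTop tendsto_const_nhds ?_
  refine tendsto_atTop_add_const_right _ _ ?_
  have := (tendsto_pow_atTop (α := ℝ) two_ne_zero).comp (tendsto_norm_cocompact_atTop (E := ℝ))
  refine this.congr fun x => ?_
  simp

/-- Tightness of `ν`, in a form that can be tested with functions vanishing at infinity. -/
theorem tendsto_integral_cauchyCutoff (ν : Measure ℝ) [IsProbabilityMeasure ν] :
    Tendsto (fun N : ℕ => ∫ x, cauchyCutoff ((N : ℝ) + 1) x ∂ν) atTop (𝓝 1) := by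
  suffices Tendsto (fun N : ℕ => ∫ x, cauchyCutoff ((N : ℝ) + 1) x ∂ν) atTop
      (𝓝 (∫ _ : ℝ, (1 : ℝ) ∂ν)) by simpa using this
  refine tendsto_integral_of_dominated_convergence (fun _ => 1)
    (fun N => (continuous_cauchyCutoff (by positivity)).aestronglyMeasurable)
    (integrable_const _) (fun N => Eventually.of_forall fun x => ?_)
    (Eventually.of_forall fun x => ?_)
  · rw [Real.norm_of_nonneg (cauchyCutoff_nonneg _ _)]
    exact cauchyCutoff_le_one _ _
  · have h2 : Tendsto (fun N : ℕ => (1 : ℝ) / (x ^ 2 * (1 / ((N : ℝ) + 1)) ^ 2 + 1)) atTop (𝓝 1) := by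
      have := ((((tendsto_one_div_add_atTop_nhds_zero_nat (𝕜 := ℝ)).pow 2).const_mul
        (x ^ 2)).add_const 1)
      have h3 := (tendsto_const_nhds (x := (1 : ℝ))).div this (by simp)
      simpa [Pi.div_def] using h3
    refine h2.congr fun N => ?_
    unfold cauchyCutoff
    have : (N : ℝ) + 1 ≠ 0 := by positivity
    field_simp

/-- Convergence in probability of the Stieltjes transforms at `i η` for all large `η` implies weak
convergence in probability. -/
theorem tendstoWeaklyInProbability_of_resolvent [∀ n ω, IsFiniteMeasure (L n ω)]
    [IsProbabilityMeasure ν] (hL : ∀ᶠ n in atTop, ∀ ω, IsProbabilityMeasure (L n ω))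
    (η₀ : ℝ) (hη₀ : 0 < η₀)
    (h : ∀ η : ℝ, η₀ ≤ η → VanishesInProbability P fun n ω =>
      (∫ x : ℝ, ((x : ℂ) - Complex.I * η)⁻¹ ∂(L n ω)) -
        ∫ x : ℝ, ((x : ℂ) - Complex.I * η)⁻¹ ∂ν) :
    TendstoWeaklyInProbability P L ν := by
  have key := vanishesInProbability_of_resolvent hL η₀ hη₀ h
  have keyR : ∀ g : ℝ → ℝ, Continuous g → Tendsto g (cocompact ℝ) (𝓝 0) →
      VanishesInProbability P fun n ω => (∫ x, g x ∂(L n ω)) - ∫ x, g x ∂ν := by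
    intro g hg hg0
    let G : C(OnePoint ℝ, ℂ) := OnePoint.continuousMapMk
      ⟨fun x => (g x : ℂ), Complex.continuous_ofReal.comp hg⟩ 0 (by
        rw [Filter.coclosedCompact_eq_cocompact]
        exact (Complex.continuous_ofReal.tendsto' 0 0 Complex.ofReal_zero).comp hg0)
    refine (key G).mono (Eventually.of_forall fun n ω => le_of_eq ?_)
    have hG : ∀ μ : Measure ℝ, ∫ x : ℝ, G (x : OnePoint ℝ) ∂μ = ((∫ x, g x ∂μ : ℝ) : ℂ) :=
      fun μ => integral_ofReal
    rw [hG, hG, ← Complex.ofReal_sub, Complex.norm_real]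
  intro f
  change VanishesInProbability P fun n ω => (∫ x, f x ∂(L n ω)) - ∫ x, f x ∂ν
  refine VanishesInProbability.of_forall_approx (F := ℝ) fun δ hδ => ?_
  -- The cut-off loses little mass of `ν`; the `+ 1` guards against `‖f‖ = 0`.
  obtain ⟨N, hN⟩ := ((Metric.tendsto_atTop.1 (tendsto_integral_cauchyCutoff ν))
    (δ / (2 * (‖f‖ + 1))) (by positivity))
  have hN := hN N le_rfl
  set R : ℝ := (N : ℝ) + 1 with hR
  have hRpos : 0 < R := by positivity
  have hχ := continuous_cauchyCutoff hRpos
  have hfχ0 : Tendsto (fun x => f x * cauchyCutoff R x) (cocompact ℝ) (𝓝 0) := by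
    refine squeeze_zero_norm (a := fun x => ‖f‖ * cauchyCutoff R x) (fun x => ?_) ?_
    · rw [norm_mul, Real.norm_of_nonneg (cauchyCutoff_nonneg _ _)]
      exact mul_le_mul_of_nonneg_right (f.norm_coe_le_norm x) (cauchyCutoff_nonneg _ _)
    · simpa using tendsto_cauchyCutoff_cocompact.const_mul ‖f‖
  have hv1 := keyR _ (f.continuous.mul hχ) hfχ0
  have hv2 := keyR _ (continuous_const.mul hχ) (by
    have := tendsto_cauchyCutoff_cocompact (R := R).const_mul ‖f‖
    rwa [mul_zero] at this)
  refine ⟨fun n ω => ‖(∫ x, f x * cauchyCutoff R x ∂(L n ω)) - ∫ x, f x * cauchyCutoff R x ∂ν‖ +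
    ‖(∫ x, ‖f‖ * cauchyCutoff R x ∂(L n ω)) - ∫ x, ‖f‖ * cauchyCutoff R x ∂ν‖,
    VanishesInProbability.add (hv1.mono (by simp)) (hv2.mono (by simp)),
    hL.mono fun n hn ω => ?_⟩
  -- The cost of the cut-off is itself controlled by an integral of a function vanishing at
  -- infinity. As such integrals converge to those of `ν`, the random measures inherit tightness
  -- from `ν`.
  have hbound : ∀ (μ : Measure ℝ) [IsProbabilityMeasure μ],
      |(∫ x, f x ∂μ) - ∫ x, f x * cauchyCutoff R x ∂μ| ≤
        ‖f‖ - ∫ x, ‖f‖ * cauchyCutoff R x ∂μ := by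
    intro μ _
    have hi1 : Integrable (fun x => f x) μ := f.integrable μ
    have hiχ : Integrable (cauchyCutoff R) μ := Integrable.of_bound hχ.aestronglyMeasurable 1
      (Eventually.of_forall fun x => by
        rw [Real.norm_of_nonneg (cauchyCutoff_nonneg _ _)]; exact cauchyCutoff_le_one _ _)
    have hi2 : Integrable (fun x => f x * cauchyCutoff R x) μ :=
      hiχ.bdd_mul (c := ‖f‖) f.continuous.aestronglyMeasurable
        (Eventually.of_forall fun x => f.norm_coe_le_norm x)
    have hc : ‖f‖ - ∫ x, ‖f‖ * cauchyCutoff R x ∂μ =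
        ∫ x, (‖f‖ - ‖f‖ * cauchyCutoff R x) ∂μ := by
      rw [integral_sub (integrable_const _) (hiχ.const_mul _)]
      simp
    rw [hc, ← integral_sub hi1 hi2, ← Real.norm_eq_abs]
    refine norm_integral_le_of_norm_le ((integrable_const _).sub (hiχ.const_mul _))
      (Eventually.of_forall fun x => ?_)
    have : f x - f x * cauchyCutoff R x = f x * (1 - cauchyCutoff R x) := by ring
    rw [this, norm_mul, Real.norm_of_nonneg (sub_nonneg.2 (cauchyCutoff_le_one R x))]
    have := mul_le_mul_of_nonneg_right (f.norm_coe_le_norm x)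
      (sub_nonneg.2 (cauchyCutoff_le_one R x))
    linarith
  have h1 := @hbound (L n ω) (hn ω)
  have h2 := hbound ν
  have h3 : ‖f‖ - ∫ x, ‖f‖ * cauchyCutoff R x ∂ν ≤ δ / 2 := by
    rw [integral_const_mul]
    rw [Real.dist_eq, abs_sub_comm] at hN
    have h4 := (le_abs_self _).trans hN.le
    have h5 : ‖f‖ * (1 - ∫ x, cauchyCutoff R x ∂ν) ≤ ‖f‖ * (δ / (2 * (‖f‖ + 1))) :=
      mul_le_mul_of_nonneg_left h4 (norm_nonneg _)
    have h6 : ‖f‖ * (δ / (2 * (‖f‖ + 1))) ≤ δ / 2 := by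
      rw [mul_div_assoc', div_le_div_iff₀ (by positivity) (by positivity)]
      nlinarith [norm_nonneg f]
    linarith
  set a := ∫ x, f x ∂(L n ω)
  set b := ∫ x, f x * cauchyCutoff R x ∂(L n ω)
  set c := ∫ x, f x ∂ν
  set d := ∫ x, f x * cauchyCutoff R x ∂ν
  set e := ∫ x, ‖f‖ * cauchyCutoff R x ∂(L n ω)
  set e' := ∫ x, ‖f‖ * cauchyCutoff R x ∂ν
  change |a - c| ≤ |(|b - d| + |e - e'|)| + δ
  have h6 : |(|b - d| + |e - e'|)| = |b - d| + |e - e'| := abs_of_nonneg (by positivity)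
  rw [h6]
  have h7 := neg_abs_le (b - d)
  have h8 := le_abs_self (b - d)
  have h9 := neg_abs_le (e - e')
  rw [abs_le] at h1 h2 ⊢
  constructor <;> linarith [h1.1, h1.2, h2.1, h2.2]

end Weak

/-! ### The semicircle law and its Stieltjes transform -/

theorem integral_sqrt_sq_sub_sq {a : ℝ} (ha : 0 < a) :
    ∫ x in (-a)..a, √(a ^ 2 - x ^ 2) = Real.pi * a ^ 2 / 2 := by
  have h := intervalIntegral.smul_integral_comp_mul_left (a := -1) (b := 1)
    (fun x => √(a ^ 2 - x ^ 2)) a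
  rw [mul_neg, mul_one] at h
  rw [← h]
  have h2 : ∀ x : ℝ, √(a ^ 2 - (a * x) ^ 2) = a * √(1 - x ^ 2) := fun x => by
    rw [show a ^ 2 - (a * x) ^ 2 = a ^ 2 * (1 - x ^ 2) by ring, Real.sqrt_mul (by positivity),
      Real.sqrt_sq ha.le]
  simp only [h2, intervalIntegral.integral_const_mul, integral_sqrt_one_sub_sq, smul_eq_mul]
  ring

theorem hasDerivAt_arcsin_mul_div_sqrt {a η x : ℝ} (hη : 0 < η) (hx : x ∈ Set.Ioo (-a) a) :
    HasDerivAt (fun x => Real.arcsin (√(a ^ 2 + η ^ 2) * x / (a * √(x ^ 2 + η ^ 2))))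
      (√(a ^ 2 + η ^ 2) * η / (√(a ^ 2 - x ^ 2) * (x ^ 2 + η ^ 2))) x := by
  have ha : 0 < a := by linarith [hx.1, hx.2]
  set s := √(a ^ 2 + η ^ 2) with hs
  have hs2 : s ^ 2 = a ^ 2 + η ^ 2 := Real.sq_sqrt (by positivity)
  have hax : 0 < a ^ 2 - x ^ 2 := by nlinarith [hx.1, hx.2]
  set q := √(a ^ 2 - x ^ 2) with hq
  have hqpos : 0 < q := Real.sqrt_pos.2 hax
  have hq2 : q ^ 2 = a ^ 2 - x ^ 2 := Real.sq_sqrt hax.le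
  have hp : 0 < x ^ 2 + η ^ 2 := by positivity
  set p := √(x ^ 2 + η ^ 2) with hpdef
  have hppos : 0 < p := Real.sqrt_pos.2 hp
  have hp2 : p ^ 2 = x ^ 2 + η ^ 2 := Real.sq_sqrt hp.le
  have hone : 1 - (s * x / (a * p)) ^ 2 = (η * q / (a * p)) ^ 2 := by
    field_simp
    rw [hq2, hp2, hs2]
    ring
  have hpos : 0 < η * q / (a * p) := by positivity
  have hlt : (s * x / (a * p)) ^ 2 < 1 := by nlinarith [pow_pos hpos 2]
  have hne1 : s * x / (a * p) ≠ -1 := by rintro h; rw [h] at hlt; norm_num at hlt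
  have hne2 : s * x / (a * p) ≠ 1 := by rintro h; rw [h] at hlt; norm_num at hlt
  have hsqrt : HasDerivAt (fun x => √(x ^ 2 + η ^ 2)) (x / p) x := by
    have := ((hasDerivAt_pow 2 x).add_const (η ^ 2)).sqrt hp.ne'
    refine this.congr_deriv ?_
    rw [← hpdef]
    field_simp
    ring
  have hin : HasDerivAt (fun x => s * x / (a * √(x ^ 2 + η ^ 2)))
      ((s * (a * p) - s * x * (a * (x / p))) / (a * p) ^ 2) x := by
    have := ((hasDerivAt_id' x).const_mul s).div (hsqrt.const_mul a) (by positivity)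
    exact this.congr_deriv (by rw [mul_one])
  refine ((Real.hasDerivAt_arcsin hne1 hne2).comp x hin).congr_deriv ?_
  rw [hone, Real.sqrt_sq hpos.le, ← hp2]
  field_simp
  rw [hp2]
  ring

/-- Writing `(a² - x²) / (x² + η²) = (a² + η²) / (x² + η²) - 1` splits the integrand into two
derivatives of arcsines. The antiderivative is continuous on the closed interval but is
differentiated only in the open one, where `√(a² - x²)` does not vanish. -/
theorem integral_sqrt_mul_div {a η : ℝ} (ha : 0 < a) (hη : 0 < η) :
    ∫ x in (-a)..a, √(a ^ 2 - x ^ 2) * (η / (x ^ 2 + η ^ 2)) =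
      Real.pi * (√(a ^ 2 + η ^ 2) - η) := by
  have hpos : ∀ x : ℝ, 0 < x ^ 2 + η ^ 2 := fun x => by positivity
  have hs0 : 0 < √(a ^ 2 + η ^ 2) := Real.sqrt_pos.2 (hpos a)
  have hcont : Continuous fun x => √(a ^ 2 + η ^ 2) *
      Real.arcsin (√(a ^ 2 + η ^ 2) * x / (a * √(x ^ 2 + η ^ 2))) - η * Real.arcsin (x / a) := by
    have : ∀ x, a * √(x ^ 2 + η ^ 2) ≠ 0 := fun x =>
      mul_ne_zero ha.ne' (Real.sqrt_pos.2 (hpos x)).ne'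
    fun_prop (disch := assumption)
  rw [intervalIntegral.integral_eq_sub_of_hasDerivAt_of_le (by linarith) hcont.continuousOn
    (fun x hx => ?_) ?_]
  · rw [neg_sq, mul_neg, neg_div, neg_div, Real.arcsin_neg, Real.arcsin_neg, div_self ha.ne',
      mul_comm a, div_self (by positivity), Real.arcsin_one]
    ring
  · refine Continuous.intervalIntegrable ?_ _ _
    have : ∀ x, x ^ 2 + η ^ 2 ≠ 0 := fun x => (hpos x).ne'
    fun_prop (disch := assumption)
  · have hax : 0 < a ^ 2 - x ^ 2 := by nlinarith [hx.1, hx.2]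
    have hq := Real.sqrt_pos.2 hax
    have h1 := (hasDerivAt_arcsin_mul_div_sqrt hη hx).const_mul (√(a ^ 2 + η ^ 2))
    have hlt : (x / a) ^ 2 < 1 := by
      rw [div_pow, div_lt_one (by positivity)]; linarith
    have h2 : HasDerivAt (fun x => Real.arcsin (x / a)) (1 / √(a ^ 2 - x ^ 2)) x := by
      have hd := (Real.hasDerivAt_arcsin (x := x / a) (by rintro h; rw [h] at hlt; norm_num at hlt)
        (by rintro h; rw [h] at hlt; norm_num at hlt)).comp x ((hasDerivAt_id x).div_const a)
      refine hd.congr_deriv ?_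
      rw [show 1 - (x / a) ^ 2 = (a ^ 2 - x ^ 2) / a ^ 2 by field_simp, Real.sqrt_div hax.le,
        Real.sqrt_sq ha.le]
      field_simp
    refine (h1.sub (h2.const_mul η)).congr_deriv ?_
    have hs2 : √(a ^ 2 + η ^ 2) ^ 2 = a ^ 2 + η ^ 2 := Real.sq_sqrt (by positivity)
    have hq2 : √(a ^ 2 - x ^ 2) ^ 2 = a ^ 2 - x ^ 2 := Real.sq_sqrt hax.le
    have := hpos x
    field_simp
    rw [hs2, hq2]
    ring

theorem semicircleDensity_eq_indicator (v : ℝ) :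
    semicircleDensity v = (Set.Icc (-(2 * √v)) (2 * √v)).indicator
      fun x => 1 / (2 * Real.pi * v) * √(4 * v - x ^ 2) := by
  ext x
  simp [semicircleDensity, Set.indicator_apply, abs_le]

theorem semicircleDensity_nonneg {v : ℝ} (hv : 0 ≤ v) (x : ℝ) : 0 ≤ semicircleDensity v x := by
  unfold semicircleDensity
  split_ifs <;> positivity

theorem measurable_semicircleDensity (v : ℝ) : Measurable (semicircleDensity v) := by
  rw [semicircleDensity_eq_indicator]
  exact Measurable.indicator (by fun_prop) measurableSet_Icc

theorem integral_semicircleLaw {E : Type*} [NormedAddCommGroup E] [NormedSpace ℝ E] {v : ℝ}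
    (hv : 0 < v) (f : ℝ → E) :
    ∫ x, f x ∂(semicircleLaw v) =
      (1 / (2 * Real.pi * v)) • ∫ x in (-(2 * √v))..(2 * √v), √((2 * √v) ^ 2 - x ^ 2) • f x := by
  have h4 : (2 * √v) ^ 2 = 4 * v := by rw [mul_pow, Real.sq_sqrt hv.le]; norm_num
  rw [semicircleLaw, if_neg hv.ne', integral_withDensity_eq_integral_toReal_smul
    (measurable_semicircleDensity v).ennreal_ofReal (by simp)]
  simp only [ENNReal.toReal_ofReal (semicircleDensity_nonneg hv.le _)]
  rw [← intervalIntegral.integral_smul, intervalIntegral.integral_of_le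
    (by linarith [Real.sqrt_nonneg v]), ← integral_Icc_eq_integral_Ioc,
    ← integral_indicator measurableSet_Icc]
  congr 1
  ext x
  rw [semicircleDensity_eq_indicator, h4]
  by_cases hx : x ∈ Set.Icc (-(2 * √v)) (2 * √v)
  · simp [hx, smul_smul]
  · simp [hx]

theorem isProbabilityMeasure_semicircleLaw {v : ℝ} (hv : 0 ≤ v) :
    IsProbabilityMeasure (semicircleLaw v) := by
  rcases hv.eq_or_lt with rfl | hv
  · rw [semicircleLaw, if_pos rfl]; infer_instance
  have h1 := integral_semicircleLaw hv fun _ => (1 : ℝ)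
  have h4 : (2 * √v) ^ 2 = 4 * v := by rw [mul_pow, Real.sq_sqrt hv.le]; norm_num
  simp only [smul_eq_mul, mul_one, integral_const] at h1
  rw [integral_sqrt_sq_sub_sq (by positivity), h4] at h1
  have h2 : (semicircleLaw v).real Set.univ = 1 := by
    rw [h1]
    have := Real.pi_pos
    field_simp
    norm_num
  refine ⟨?_⟩
  rw [Measure.real, ENNReal.toReal_eq_one_iff] at h2
  exact h2

/-- The value at `i η` of the Stieltjes transform of the semicircle law of variance `v`. -/
noncomputable def semicircleTransform (v η : ℝ) : ℂ :=
  ∫ x : ℝ, ((x : ℂ) - Complex.I * η)⁻¹ ∂(semicircleLaw v)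

theorem semicircleTransform_eq {v η : ℝ} (hv : 0 < v) (hη : 0 < η) :
    semicircleTransform v η = Complex.I * ((√(4 * v + η ^ 2) - η) / (2 * v) : ℝ) := by
  have h4 : (2 * √v) ^ 2 = 4 * v := by rw [mul_pow, Real.sq_sqrt hv.le]; norm_num
  have ha : 0 < 2 * √v := by positivity
  rw [semicircleTransform, integral_semicircleLaw hv]
  set a := 2 * √v with hadef
  have hpos : ∀ x : ℝ, x ^ 2 + η ^ 2 ≠ 0 := fun x => by positivity
  have hsplit : ∀ x : ℝ, √(a ^ 2 - x ^ 2) • ((x : ℂ) - Complex.I * η)⁻¹ =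
      ((√(a ^ 2 - x ^ 2) * (x / (x ^ 2 + η ^ 2)) : ℝ) : ℂ) +
        Complex.I * ((√(a ^ 2 - x ^ 2) * (η / (x ^ 2 + η ^ 2)) : ℝ) : ℂ) := by
    intro x
    have h1 := ofReal_sub_I_mul_ne_zero x hη
    have h2 : (x : ℂ) ^ 2 + (η : ℂ) ^ 2 ≠ 0 := by exact_mod_cast hpos x
    rw [Complex.real_smul]
    push_cast
    field_simp
    linear_combination ((√(a ^ 2 - x ^ 2) : ℂ) * (η : ℂ) ^ 2) * Complex.I_sq
  -- The real part of the transform vanishes by symmetry, so the transform is purely imaginary.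
  have hodd : ∫ x in (-a)..a, √(a ^ 2 - x ^ 2) * (x / (x ^ 2 + η ^ 2)) = 0 := by
    have h := intervalIntegral.integral_comp_neg (a := -a) (b := a)
      (fun x => √(a ^ 2 - x ^ 2) * (x / (x ^ 2 + η ^ 2)))
    rw [neg_neg] at h
    have h' : ∀ x : ℝ, √(a ^ 2 - (-x) ^ 2) * (-x / ((-x) ^ 2 + η ^ 2)) =
        -(√(a ^ 2 - x ^ 2) * (x / (x ^ 2 + η ^ 2))) := fun x => by rw [neg_sq]; ring
    simp only [h', intervalIntegral.integral_neg] at h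
    linarith
  simp only [hsplit]
  rw [intervalIntegral.integral_add, intervalIntegral.integral_const_mul,
    intervalIntegral.integral_ofReal, intervalIntegral.integral_ofReal, hodd,
    integral_sqrt_mul_div ha hη, h4, Complex.real_smul]
  · have := Real.pi_ne_zero
    have hv' : (v : ℂ) ≠ 0 := by exact_mod_cast hv.ne'
    have hpi : (Real.pi : ℂ) ≠ 0 := by exact_mod_cast Real.pi_ne_zero
    push_cast
    field_simp
    ring
  · refine Continuous.intervalIntegrable ?_ _ _
    refine Complex.continuous_ofReal.comp ?_
    fun_prop (disch := assumption)
  · refine Continuous.intervalIntegrable ?_ _ _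
    refine continuous_const.mul (Complex.continuous_ofReal.comp ?_)
    fun_prop (disch := assumption)

theorem norm_semicircleTransform_le {v η : ℝ} (hv : 0 ≤ v) (hη : 0 < η) :
    ‖semicircleTransform v η‖ ≤ η⁻¹ := by
  have := isProbabilityMeasure_semicircleLaw hv
  refine (norm_integral_le_of_norm_le_const (C := η⁻¹)
    (Eventually.of_forall fun x => norm_inv_ofReal_sub_I_mul_le x hη)).trans (by simp)

/-- The Stieltjes transform of the semicircle law solves the equation `m (-z - v m) = 1`. -/
theorem semicircleTransform_mul {v η : ℝ} (hv : 0 ≤ v) (hη : 0 < η) :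
    semicircleTransform v η * (-(Complex.I * η) - v * semicircleTransform v η) = 1 := by
  rcases hv.eq_or_lt with rfl | hv
  · have hη' : (η : ℂ) ≠ 0 := by exact_mod_cast hη.ne'
    rw [semicircleTransform, semicircleLaw, if_pos rfl, integral_dirac]
    simp
    field_simp
    simp
  · rw [semicircleTransform_eq hv hη]
    have hs2 : √(4 * v + η ^ 2) ^ 2 = 4 * v + η ^ 2 := Real.sq_sqrt (by positivity)
    set s := √(4 * v + η ^ 2)
    have hr : (s - η) / (2 * v) * η + v * ((s - η) / (2 * v)) ^ 2 = 1 := by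
      field_simp
      linear_combination hs2
    set y := (s - η) / (2 * v)
    have hc : (y : ℂ) * η + v * (y : ℂ) ^ 2 = 1 := by exact_mod_cast hr
    linear_combination hc - ((y : ℂ) * η + v * (y : ℂ) ^ 2) * Complex.I_sq

/-! ### Resolvents, the Schur complement and the self-consistent equation -/

section Resolvent

theorem isHermitian_map_ofReal {ι : Type*} {A : Matrix ι ι ℝ} (hA : A.IsHermitian) :
    (A.map Complex.ofReal).IsHermitian := by
  ext i j
  have := hA.apply i j
  simp only [star_trivial] at this
  simp [this]

/-- The matrix obtained from `A` by replacing the row and the column of index `i` by zero. -/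
def deleteRowCol {ι : Type*} [DecidableEq ι] (A : Matrix ι ι ℝ) (i : ι) : Matrix ι ι ℝ :=
  Matrix.of fun j k => if j = i ∨ k = i then 0 else A j k

/-- The row of index `i` of `A` with its diagonal entry replaced by zero. -/
def offDiagRow {ι : Type*} [DecidableEq ι] (A : Matrix ι ι ℝ) (i : ι) : ι → ℝ :=
  fun j => if j = i then 0 else A i j

theorem isHermitian_deleteRowCol {ι : Type*} [DecidableEq ι] {A : Matrix ι ι ℝ}
    (hA : A.IsHermitian) (i : ι) : (deleteRowCol A i).IsHermitian := by
  ext j k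
  have := hA.apply j k
  simp only [star_trivial] at this
  simp [deleteRowCol, this, or_comm]

variable {ι : Type*} [DecidableEq ι]

/-- The complex matrix `A - i η` for a real matrix `A`. -/
noncomputable def shiftedMatrix (A : Matrix ι ι ℝ) (η : ℝ) : Matrix ι ι ℂ :=
  A.map Complex.ofReal - (Complex.I * η) • (1 : Matrix ι ι ℂ)

/-- Restoring row and column `i` is a perturbation of rank at most two; the diagonal entry is
carried by the row term. -/
theorem shiftedMatrix_eq_deleteRowCol_add {A : Matrix ι ι ℝ} {η : ℝ} (hA : A.IsHermitian) (i : ι) :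
    shiftedMatrix A η = shiftedMatrix (deleteRowCol A i) η +
      Matrix.vecMulVec (Pi.single i 1) (fun k => (offDiagRow A i k : ℂ) +
        (A i i : ℂ) * Pi.single (M := fun _ => ℂ) i 1 k) +
      Matrix.vecMulVec (fun k => (offDiagRow A i k : ℂ)) (Pi.single i 1) := by
  ext j k
  have := hA.apply j k
  simp only [star_trivial] at this
  simp only [shiftedMatrix, deleteRowCol, offDiagRow, Matrix.vecMulVec_apply, Matrix.add_apply,
    Matrix.sub_apply, Matrix.map_apply, Matrix.of_apply, Pi.single_apply]
  by_cases hj : j = i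
  · subst hj
    by_cases hk : k = j
    · subst hk; simp; ring
    · simp [hk]; ring
  · by_cases hk : k = i
    · subst hk; simp [hj, this]
    · simp [hj, hk]

variable [Fintype ι]

/-- The resolvent `(A - i η)⁻¹` of a real matrix `A`. -/
noncomputable def resolventMatrix (A : Matrix ι ι ℝ) (η : ℝ) : Matrix ι ι ℂ :=
  (shiftedMatrix A η)⁻¹

variable {A : Matrix ι ι ℝ} {η : ℝ}

/-- The Hermitian part contributes only a real number. This one identity gives both the
invertibility of `A - iη` and, applied to a column of the resolvent, the Ward identity below. -/
theorem im_star_dotProduct_shiftedMatrix_mulVec (hA : A.IsHermitian) (u : ι → ℂ) :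
    (star u ⬝ᵥ (shiftedMatrix A η).mulVec u).im = -(η * ∑ j, ‖u j‖ ^ 2) := by
  have h1 := (isHermitian_map_ofReal hA).im_star_dotProduct_mulVec_self u
  have h2 : star u ⬝ᵥ u = ((∑ j, ‖u j‖ ^ 2 : ℝ) : ℂ) := by
    simp [dotProduct, Complex.conj_mul']
  rw [shiftedMatrix, Matrix.sub_mulVec, dotProduct_sub, Matrix.smul_mulVec, Matrix.one_mulVec,
    dotProduct_smul, h2, Complex.sub_im]
  have h3 : (star u ⬝ᵥ (A.map Complex.ofReal).mulVec u).im = 0 := h1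
  rw [h3, smul_eq_mul, mul_assoc, ← Complex.ofReal_mul, Complex.I_mul_im, Complex.ofReal_re]
  ring

theorem isUnit_det_shiftedMatrix (hA : A.IsHermitian) (hη : 0 < η) :
    IsUnit (shiftedMatrix A η).det := by
  rw [isUnit_iff_ne_zero]
  intro h
  obtain ⟨u, hu, hu0⟩ := Matrix.exists_mulVec_eq_zero_iff.2 h
  have h1 := im_star_dotProduct_shiftedMatrix_mulVec (η := η) hA u
  rw [hu0, dotProduct_zero, Complex.zero_im, eq_comm, neg_eq_zero, mul_eq_zero,
    or_iff_right hη.ne', Finset.sum_eq_zero_iff_of_nonneg (fun _ _ => by positivity)] at h1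
  exact hu (funext fun j => by simpa using h1 j (Finset.mem_univ j))

theorem shiftedMatrix_mul_resolventMatrix (hA : A.IsHermitian) (hη : 0 < η) :
    shiftedMatrix A η * resolventMatrix A η = 1 :=
  Matrix.mul_nonsing_inv _ (isUnit_det_shiftedMatrix hA hη)

theorem resolventMatrix_mul_shiftedMatrix (hA : A.IsHermitian) (hη : 0 < η) :
    resolventMatrix A η * shiftedMatrix A η = 1 :=
  Matrix.nonsing_inv_mul _ (isUnit_det_shiftedMatrix hA hη)

theorem resolventMatrix_symm (hA : A.IsHermitian) (i j : ι) :
    resolventMatrix A η i j = resolventMatrix A η j i := by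
  have h : (shiftedMatrix A η).transpose = shiftedMatrix A η := by
    ext i j
    have := hA.apply i j
    simp only [star_trivial] at this
    simp [shiftedMatrix, this, Matrix.one_apply, eq_comm]
  have h2 : (resolventMatrix A η).transpose = resolventMatrix A η := by
    rw [resolventMatrix, Matrix.transpose_nonsing_inv, h]
  exact congrFun (congrFun h2 j) i

/-- The Ward identity: a whole column of the resolvent is controlled by its diagonal entry. All
later bounds on `G`, with no loss in the dimension, come from here. -/
theorem mul_sum_norm_sq_resolventMatrix (hA : A.IsHermitian) (hη : 0 < η) (i : ι) :
    η * ∑ j, ‖resolventMatrix A η j i‖ ^ 2 = (resolventMatrix A η i i).im := by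
  have h1 := im_star_dotProduct_shiftedMatrix_mulVec (η := η) hA fun j => resolventMatrix A η j i
  have h2 : (shiftedMatrix A η).mulVec (fun j => resolventMatrix A η j i) = Pi.single i 1 := by
    ext k
    have := congrFun (congrFun (shiftedMatrix_mul_resolventMatrix hA hη) k) i
    rw [Matrix.mul_apply] at this
    simpa [Matrix.mulVec, dotProduct, Matrix.one_apply, Pi.single_apply] using this
  rw [h2, dotProduct_single_one] at h1
  simpa using h1.symm

theorem mul_sum_norm_sq_resolventMatrix_le (hA : A.IsHermitian) (hη : 0 < η) (i : ι) :
    η * ∑ j, ‖resolventMatrix A η j i‖ ^ 2 ≤ ‖resolventMatrix A η i i‖ :=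
  (mul_sum_norm_sq_resolventMatrix hA hη i).le.trans
    ((le_abs_self _).trans (Complex.abs_im_le_norm _))

theorem norm_resolventMatrix_diag_le (hA : A.IsHermitian) (hη : 0 < η) (i : ι) :
    ‖resolventMatrix A η i i‖ ≤ η⁻¹ := by
  have h1 := mul_sum_norm_sq_resolventMatrix_le hA hη i
  have h2 : ‖resolventMatrix A η i i‖ ^ 2 ≤ ∑ j, ‖resolventMatrix A η j i‖ ^ 2 :=
    Finset.single_le_sum (f := fun j => ‖resolventMatrix A η j i‖ ^ 2) (fun _ _ => by positivity)
      (Finset.mem_univ i)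
  rcases (norm_nonneg (resolventMatrix A η i i)).eq_or_lt with h0 | h0
  · rw [← h0]; positivity
  · rw [le_inv_comm₀ h0 hη, ← one_div, le_div_iff₀ h0]
    by_contra! hlt
    nlinarith [mul_le_mul_of_nonneg_left h2 hη.le]

theorem sum_norm_sq_resolventMatrix_le (hA : A.IsHermitian) (hη : 0 < η) (i : ι) :
    ∑ j, ‖resolventMatrix A η j i‖ ^ 2 ≤ (η⁻¹) ^ 2 := by
  have h := (mul_sum_norm_sq_resolventMatrix_le hA hη i).trans (norm_resolventMatrix_diag_le hA hη i)
  rw [mul_comm, ← le_div_iff₀ hη] at h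
  rwa [pow_two, ← div_eq_mul_inv]

/-- The trace of the resolvent in terms of the eigenvalues. -/
theorem trace_resolventMatrix (hA : A.IsHermitian) (hη : 0 < η) :
    (resolventMatrix A η).trace = ∑ i, ((hA.eigenvalues i : ℂ) - Complex.I * η)⁻¹ := by
  set U : Matrix ι ι ℝ := (hA.eigenvectorUnitary : Matrix ι ι ℝ) with hU
  have hUU : U * U.transpose = 1 := by
    have : U * star U = 1 := Unitary.coe_mul_star_self hA.eigenvectorUnitary
    rwa [Matrix.star_eq_conjTranspose, Matrix.conjTranspose_eq_transpose_of_trivial] at this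
  have hAU : A * U = U * Matrix.diagonal hA.eigenvalues := by
    ext i j
    have := congrFun (hA.mulVec_eigenvectorBasis j) i
    rw [Matrix.mul_diagonal, mul_comm]
    simpa [Matrix.mul_apply, Matrix.mulVec, dotProduct, hU] using this
  set V : Matrix ι ι ℂ := U.map Complex.ofRealHom with hV
  have hVV : V * V.transpose = 1 := by
    rw [hV, ← Matrix.transpose_map, ← Matrix.map_mul, hUU]
    simp
  have hMV : shiftedMatrix A η * V =
      V * Matrix.diagonal fun i => (hA.eigenvalues i : ℂ) - Complex.I * η := by
    have h : A.map Complex.ofRealHom * V =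
        V * (Matrix.diagonal hA.eigenvalues).map Complex.ofRealHom := by
      rw [hV, ← Matrix.map_mul, hAU, Matrix.map_mul]
    have h' : A.map Complex.ofReal * V =
        V * (Matrix.diagonal hA.eigenvalues).map Complex.ofRealHom := h
    rw [shiftedMatrix, sub_mul, h', Matrix.smul_mul, one_mul]
    ext i j
    simp [Matrix.mul_diagonal, Matrix.diagonal_map]
    ring
  have hinv : resolventMatrix A η =
      V * (Matrix.diagonal fun i => ((hA.eigenvalues i : ℂ) - Complex.I * η)⁻¹) * V.transpose := by
    refine Matrix.inv_eq_right_inv ?_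
    rw [← mul_assoc, ← mul_assoc, hMV, mul_assoc V, Matrix.diagonal_mul_diagonal]
    simp_rw [mul_inv_cancel₀ (ofReal_sub_I_mul_ne_zero _ hη)]
    rw [Matrix.diagonal_one, mul_one, hVV]
  rw [hinv, Matrix.trace_mul_comm, ← mul_assoc, mul_eq_one_comm.1 hVV, one_mul,
    Matrix.trace_diagonal]

/-- Deletion keeps the index `i`, as a zero row and column; the shifted matrix is then block
diagonal with the isolated entry `-iη`. -/
theorem resolventMatrix_deleteRowCol_apply_of_ne (hA : A.IsHermitian) (hη : 0 < η) {i j : ι}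
    (hij : j ≠ i) : resolventMatrix (deleteRowCol A i) η i j = 0 := by
  have h := congrFun (congrFun (shiftedMatrix_mul_resolventMatrix (isHermitian_deleteRowCol hA i) hη)
    i) j
  rw [Matrix.mul_apply, Finset.sum_eq_single i] at h
  · have h0 : (η : ℂ) ≠ 0 := by exact_mod_cast hη.ne'
    simpa [shiftedMatrix, deleteRowCol, hij.symm, h0] using h
  · intro k _ hk
    simp [shiftedMatrix, deleteRowCol, hk.symm]
  · simp

/-- The quadratic form of the resolvent of `A` with row and column `i` deleted, evaluated at
row `i` of `A`. -/
noncomputable def schurForm (A : Matrix ι ι ℝ) (η : ℝ) (i : ι) : ℂ :=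
  ∑ j, ∑ k, (offDiagRow A i j : ℂ) * (offDiagRow A i k : ℂ) *
    resolventMatrix (deleteRowCol A i) η j k

/-- The Schur complement formula, for a whole column of the resolvent. -/
theorem schur_mul_resolventMatrix (hA : A.IsHermitian) (hη : 0 < η) (i j : ι) :
    ((A i i : ℂ) - Complex.I * η - schurForm A η i) * resolventMatrix A η j i =
      Pi.single (M := fun _ => ℂ) i 1 j -
        (resolventMatrix (deleteRowCol A i) η).mulVec (fun k => (offDiagRow A i k : ℂ)) j := by
  set B := resolventMatrix (deleteRowCol A i) η with hB
  set a : ι → ℂ := fun k => (offDiagRow A i k : ℂ) with ha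
  set e : ι → ℂ := Pi.single i 1 with he
  set c : ℂ := (A i i : ℂ) - Complex.I * η - schurForm A η i with hc
  have hai : a i = 0 := by simp [ha, offDiagRow]
  have hBai : B.mulVec a i = 0 := by
    refine Finset.sum_eq_zero fun k _ => ?_
    by_cases hk : k = i
    · rw [hk, hai, mul_zero]
    · change B i k * a k = 0
      rw [hB, resolventMatrix_deleteRowCol_apply_of_ne hA hη hk, zero_mul]
  have haBa : a ⬝ᵥ B.mulVec a = schurForm A η i := by
    simp only [schurForm, dotProduct, Matrix.mulVec, Finset.mul_sum]
    refine Finset.sum_congr rfl fun j _ => Finset.sum_congr rfl fun k _ => ?_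
    ring
  have hM'e : (shiftedMatrix (deleteRowCol A i) η).mulVec e = -(Complex.I * η) • e := by
    ext k
    by_cases hk : k = i <;>
      simp [he, shiftedMatrix, deleteRowCol, hk]
  have hM'B : (shiftedMatrix (deleteRowCol A i) η).mulVec (B.mulVec a) = a := by
    rw [Matrix.mulVec_mulVec, hB,
      shiftedMatrix_mul_resolventMatrix (isHermitian_deleteRowCol hA i) hη, Matrix.one_mulVec]
  -- The vector `e - B a` solves the column equation up to the scalar `c`: the term `a` from the
  -- column perturbation cancels the image of `B a`, and the row term supplies `A i i - aᵀ B a`.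
  have hMu : (shiftedMatrix A η).mulVec (e - B.mulVec a) = c • e := by
    have h1 : (fun k => a k + (A i i : ℂ) * e k) ⬝ᵥ (e - B.mulVec a) =
        (A i i : ℂ) - schurForm A η i := by
      have : (fun k => a k + (A i i : ℂ) * e k) = a + (A i i : ℂ) • e := rfl
      rw [this, add_dotProduct, dotProduct_sub, haBa, smul_dotProduct, dotProduct_sub, he,
        dotProduct_single_one, single_one_dotProduct, single_one_dotProduct, hai, hBai,
        Pi.single_eq_same, smul_eq_mul]
      ring
    have h2 : e ⬝ᵥ (e - B.mulVec a) = 1 := by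
      rw [he, single_one_dotProduct, Pi.sub_apply, hBai, Pi.single_eq_same, sub_zero]
    rw [shiftedMatrix_eq_deleteRowCol_add hA i, Matrix.add_mulVec, Matrix.add_mulVec,
      Matrix.vecMulVec_mulVec, Matrix.vecMulVec_mulVec, h1, h2, Matrix.mulVec_sub, hM'e, hM'B]
    ext k
    simp [hc]
    ring
  have h := congrArg ((resolventMatrix A η).mulVec) hMu
  rw [Matrix.mulVec_mulVec, resolventMatrix_mul_shiftedMatrix hA hη, Matrix.one_mulVec,
    Matrix.mulVec_smul] at h
  have hj := congrFun h j
  rw [he, Pi.smul_apply, Matrix.mulVec_single_one, smul_eq_mul] at hj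
  exact hj.symm

theorem schur_mul_resolventMatrix_self (hA : A.IsHermitian) (hη : 0 < η) (i : ι) :
    ((A i i : ℂ) - Complex.I * η - schurForm A η i) * resolventMatrix A η i i = 1 := by
  rw [schur_mul_resolventMatrix hA hη, Pi.single_eq_same, sub_eq_self]
  refine Finset.sum_eq_zero fun k _ => ?_
  by_cases hk : k = i
  · simp [hk, offDiagRow]
  · change resolventMatrix (deleteRowCol A i) η i k * (offDiagRow A i k : ℂ) = 0
    rw [resolventMatrix_deleteRowCol_apply_of_ne hA hη hk, zero_mul]

/-- The diagonal of the resolvent identity `B (M - M') G = B - G`. One of the two rank-one terms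
dies because `B j i = 0`, and the Schur formula expresses the factor `(B a) j` of the other through
`G j i`. -/
theorem resolventMatrix_diag_sub_deleteRowCol (hA : A.IsHermitian) (hη : 0 < η) {i j : ι}
    (hij : j ≠ i) :
    resolventMatrix A η j j - resolventMatrix (deleteRowCol A i) η j j =
      ((A i i : ℂ) - Complex.I * η - schurForm A η i) *
        (resolventMatrix A η j i * resolventMatrix A η j i) := by
  rw [← mul_assoc, schur_mul_resolventMatrix hA hη, Pi.single_eq_of_ne hij, zero_sub]
  have hBji := resolventMatrix_deleteRowCol_apply_of_ne hA hη hij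
  rw [resolventMatrix_symm (isHermitian_deleteRowCol hA i)] at hBji
  have h1 : resolventMatrix (deleteRowCol A i) η * (shiftedMatrix A η -
      shiftedMatrix (deleteRowCol A i) η) * resolventMatrix A η =
      resolventMatrix (deleteRowCol A i) η - resolventMatrix A η := by
    rw [mul_sub, sub_mul, mul_assoc, shiftedMatrix_mul_resolventMatrix hA hη, mul_one,
      resolventMatrix_mul_shiftedMatrix (isHermitian_deleteRowCol hA i) hη, one_mul]
  rw [shiftedMatrix_eq_deleteRowCol_add hA i, add_assoc, add_sub_cancel_left, mul_add, add_mul,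
    Matrix.mul_vecMulVec, Matrix.mul_vecMulVec, Matrix.vecMulVec_mul, Matrix.vecMulVec_mul] at h1
  have h2 := congrFun (congrFun h1 j) j
  rw [Matrix.add_apply, Matrix.vecMulVec_apply, Matrix.vecMulVec_apply, Matrix.sub_apply,
    Matrix.mulVec_single_one, Matrix.single_one_vecMul] at h2
  simp only [Matrix.col_apply, Matrix.row_apply, hBji, zero_mul, zero_add] at h2
  rw [resolventMatrix_symm hA j i]
  linear_combination h2

/-- The fluctuation of the quadratic form `schurForm` around its conditional mean, for entries with
variances `s i j`. -/
noncomputable def schurError (s : ι → ι → ℝ) (A : Matrix ι ι ℝ) (η : ℝ) (i : ι) : ℂ :=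
  schurForm A η i -
    ∑ j, ((if j = i then 0 else s i j : ℝ) : ℂ) * resolventMatrix (deleteRowCol A i) η j j

/-- The approximate self-consistent equation for a diagonal entry of the resolvent. -/
theorem norm_resolventMatrix_diag_sub_le (hA : A.IsHermitian) (hη : 0 < η) {s : ι → ι → ℝ}
    {S v : ℝ} {m : ℂ} (hs0 : ∀ i j, 0 ≤ s i j) (hsS : ∀ i j, s i j ≤ S)
    (hm : m * (-(Complex.I * η) - v * m) = 1) (hmη : ‖m‖ ≤ η⁻¹) (i : ι) :
    ‖resolventMatrix A η i i - m‖ ≤ (η⁻¹) ^ 2 * (∑ j, s i j * ‖resolventMatrix A η j j - m‖ +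
      |∑ j, s i j - v| * η⁻¹ + |A i i| + ‖schurError s A η i‖ + 2 * S * η⁻¹) := by
  set G := resolventMatrix A η with hG
  set B := resolventMatrix (deleteRowCol A i) η with hB
  set c : ℂ := (A i i : ℂ) - Complex.I * η - schurForm A η i with hc
  have hcG : c * G i i = 1 := schur_mul_resolventMatrix_self hA hη i
  set s' : ι → ℝ := fun j => if j = i then 0 else s i j with hs'
  have hs'0 : ∀ j, 0 ≤ s' j := fun j => by simp only [hs']; split_ifs; exacts [le_rfl, hs0 i j]
  have hS : 0 ≤ S := (hs0 i i).trans (hsS i i)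
  have hs'S : ∀ j, s' j ≤ S := fun j => by simp only [hs']; split_ifs; exacts [hS, hsS i j]
  have hsum : ∀ f : ι → ℂ, ∑ j, (s i j : ℂ) * f j = ∑ j, (s' j : ℂ) * f j + s i i * f i := by
    intro f
    rw [← Finset.sum_erase_add _ _ (Finset.mem_univ i), ← Finset.sum_erase_add _
      (fun j => (s' j : ℂ) * f j) (Finset.mem_univ i)]
    have : ∑ j ∈ Finset.univ.erase i, (s' j : ℂ) * f j =
        ∑ j ∈ Finset.univ.erase i, (s i j : ℂ) * f j :=
      Finset.sum_congr rfl fun j hj => by simp [hs', Finset.ne_of_mem_erase hj]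
    rw [this]
    simp [hs']
  -- The difference of `1 / m = -iη - v m` and `1 / G i i = A i i - iη - Q`, cleared of
  -- denominators.
  have hid : G i i - m = G i i * m * (schurForm A η i - v * m - A i i) := by
    linear_combination (-G i i) * hm + m * hcG
  have hmean : ∑ j, (s i j : ℂ) * (G j j - m) = ∑ j, (s i j : ℂ) * G j j - (∑ j, s i j : ℝ) * m := by
    simp_rw [mul_sub, Finset.sum_sub_distrib, ← Finset.sum_mul]
    push_cast
    rfl
  have hsplit : schurForm A η i - v * m - A i i = schurError s A η i +
      (∑ j, (s' j : ℂ) * (B j j - G j j) - s i i * G i i +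
        (∑ j, (s i j : ℂ) * (G j j - m) + ((∑ j, s i j - v : ℝ) : ℂ) * m - A i i)) := by
    rw [hmean, hsum, schurError]
    simp_rw [mul_sub, Finset.sum_sub_distrib]
    push_cast
    simp only [hs']
    ring
  -- By the Ward identity the sum is at most `S ‖c‖ ‖G i i‖ / η`, and `c * G i i = 1` removes `c`,
  -- so no separate bound on `c` is needed.
  have h1 : ‖∑ j, (s' j : ℂ) * (B j j - G j j)‖ ≤ S * η⁻¹ := by
    have hterm : ∀ j, ‖(s' j : ℂ) * (B j j - G j j)‖ ≤ S * (‖c‖ * ‖G j i‖ ^ 2) := by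
      intro j
      by_cases hj : j = i
      · simp only [hs', hj, if_true, Complex.ofReal_zero, zero_mul, norm_zero]
        positivity
      · rw [norm_mul, norm_sub_rev, hG, hB, resolventMatrix_diag_sub_deleteRowCol hA hη hj, ← hc,
          norm_mul, norm_mul, ← pow_two, Complex.norm_real, Real.norm_of_nonneg (hs'0 j)]
        exact mul_le_mul_of_nonneg_right (hs'S j) (by positivity)
    calc ‖∑ j, (s' j : ℂ) * (B j j - G j j)‖ ≤ ∑ j, S * (‖c‖ * ‖G j i‖ ^ 2) :=
        norm_sum_le_of_le _ fun j _ => hterm j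
      _ = S * (‖c‖ * (∑ j, ‖G j i‖ ^ 2)) := by rw [Finset.mul_sum, Finset.mul_sum]
      _ ≤ S * (‖c‖ * (‖G i i‖ * η⁻¹)) := by
        have := mul_sum_norm_sq_resolventMatrix_le hA hη i
        rw [mul_comm, ← le_div_iff₀ hη, div_eq_mul_inv] at this
        gcongr
      _ = S * η⁻¹ := by rw [← mul_assoc ‖c‖, ← norm_mul, hcG, norm_one, one_mul]
  have hGη := norm_resolventMatrix_diag_le hA hη i
  have h2 : ‖(s i i : ℂ) * G i i‖ ≤ S * η⁻¹ := by
    rw [norm_mul, Complex.norm_real, Real.norm_of_nonneg (hs0 i i)]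
    exact mul_le_mul (hsS i i) hGη (norm_nonneg _) hS
  have h3 : ‖∑ j, (s i j : ℂ) * (G j j - m)‖ ≤ ∑ j, s i j * ‖G j j - m‖ := by
    refine norm_sum_le_of_le _ fun j _ => ?_
    rw [norm_mul, Complex.norm_real, Real.norm_of_nonneg (hs0 i j)]
  have h4 : ‖((∑ j, s i j - v : ℝ) : ℂ) * m‖ ≤ |∑ j, s i j - v| * η⁻¹ := by
    rw [norm_mul, Complex.norm_real, Real.norm_eq_abs]
    gcongr
  have h5 : ‖(A i i : ℂ)‖ = |A i i| := by rw [Complex.norm_real, Real.norm_eq_abs]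
  rw [hid, norm_mul, norm_mul, pow_two, hsplit]
  refine mul_le_mul (mul_le_mul hGη hmη (norm_nonneg _) (by positivity)) ?_ (norm_nonneg _)
    (by positivity)
  refine (norm_add_le _ _).trans ?_
  have t1 := norm_add_le (∑ j, (s' j : ℂ) * (B j j - G j j) - s i i * G i i)
    (∑ j, (s i j : ℂ) * (G j j - m) + ((∑ j, s i j - v : ℝ) : ℂ) * m - A i i)
  have t2 := norm_sub_le (∑ j, (s' j : ℂ) * (B j j - G j j)) (s i i * G i i)
  have t3 := norm_sub_le (∑ j, (s i j : ℂ) * (G j j - m) + ((∑ j, s i j - v : ℝ) : ℂ) * m) (A i i)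
  have t4 := norm_add_le (∑ j, (s i j : ℂ) * (G j j - m)) (((∑ j, s i j - v : ℝ) : ℂ) * m)
  linarith

/-- The distance between the trace of the resolvent and the solution `m` of the self-consistent
equation. -/
theorem norm_trace_resolventMatrix_sub_le (hA : A.IsHermitian) (hη : 0 < η) {s : ι → ι → ℝ}
    {S v δ : ℝ} {m : ℂ} (hs0 : ∀ i j, 0 ≤ s i j) (hsS : ∀ i j, s i j ≤ S)
    (hsymm : ∀ i j, s i j = s j i) (hδ : ∀ i, |∑ j, s i j - v| ≤ δ) (hδ1 : δ ≤ 1)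
    (hηv : 2 * (v + 1) ≤ η ^ 2)
    (hm : m * (-(Complex.I * η) - v * m) = 1) (hmη : ‖m‖ ≤ η⁻¹) :
    ‖(resolventMatrix A η).trace - Fintype.card ι * m‖ ≤ 2 * (η⁻¹) ^ 2 *
      ∑ i, (δ * η⁻¹ + |A i i| + ‖schurError s A η i‖ + 2 * S * η⁻¹) := by
  set d : ι → ℝ := fun i => ‖resolventMatrix A η i i - m‖ with hd
  have hd0 : ∀ i, 0 ≤ d i := fun i => norm_nonneg _
  have hη2 : 0 ≤ (η⁻¹) ^ 2 := by positivity
  have htr : ‖(resolventMatrix A η).trace - Fintype.card ι * m‖ ≤ ∑ i, d i := by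
    have : (resolventMatrix A η).trace - Fintype.card ι * m =
        ∑ i, (resolventMatrix A η i i - m) := by
      simp [Matrix.trace]
    rw [this]
    exact norm_sum_le _ _
  refine htr.trans ?_
  have h1 : ∑ i, d i ≤ ∑ i, (η⁻¹) ^ 2 * (∑ j, s i j * d j +
      (δ * η⁻¹ + |A i i| + ‖schurError s A η i‖ + 2 * S * η⁻¹)) := by
    refine Finset.sum_le_sum fun i _ => ?_
    refine (norm_resolventMatrix_diag_sub_le hA hη hs0 hsS hm hmη i).trans ?_
    refine mul_le_mul_of_nonneg_left ?_ hη2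
    have : |∑ j, s i j - v| * η⁻¹ ≤ δ * η⁻¹ :=
      mul_le_mul_of_nonneg_right (hδ i) (by positivity)
    linarith
  -- After exchanging the sums, column sums of `s` appear; symmetry turns them into row sums, at
  -- most `v + δ ≤ v + 1`.
  have h2 : ∑ i, ∑ j, s i j * d j ≤ (v + 1) * ∑ j, d j := by
    rw [Finset.sum_comm, Finset.mul_sum]
    refine Finset.sum_le_sum fun j _ => ?_
    rw [← Finset.sum_mul]
    refine mul_le_mul_of_nonneg_right ?_ (hd0 j)
    simp_rw [hsymm _ j]
    linarith [le_abs_self (∑ i, s j i - v), hδ j]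
  rw [← Finset.mul_sum, Finset.sum_add_distrib] at h1
  -- Half of `∑ d` is absorbed into the left-hand side; hence the factor `2` in the conclusion.
  have h3 : (η⁻¹) ^ 2 * ∑ i, ∑ j, s i j * d j ≤ 1 / 2 * ∑ j, d j := by
    refine (mul_le_mul_of_nonneg_left h2 hη2).trans ?_
    rw [← mul_assoc]
    refine mul_le_mul_of_nonneg_right ?_ (Finset.sum_nonneg fun j _ => hd0 j)
    rw [inv_pow, inv_mul_le_iff₀ (by positivity)]
    linarith
  rw [mul_add] at h1
  linarith

end Resolvent

/-! ### Second moments of quadratic forms in independent variables -/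

section QuadraticForm

variable {Ω : Type*} [MeasurableSpace Ω] {P : Measure Ω} [IsProbabilityMeasure P]
  {ι : Type*} {x : ι → Ω → ℝ} {R : ℝ}

/-- Independence makes the variance additive, and each variable has second moment at most `R ^ 2`.
-/
theorem integral_sq_linearForm_le (hind : iIndepFun x P) (hmeas : ∀ j, Measurable (x j))
    (hbd : ∀ j, ∀ᵐ ω ∂P, |x j ω| ≤ R) (h0 : ∀ j, ∫ ω, x j ω ∂P = 0) (d : ι → ℝ) (t : Finset ι) :
    ∫ ω, (∑ j ∈ t, d j * x j ω) ^ 2 ∂P ≤ R ^ 2 * ∑ j ∈ t, d j ^ 2 := by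
  have hL : ∀ j, MemLp (x j) ⊤ P := fun j =>
    memLp_top_of_bound (hmeas j).aestronglyMeasurable R (hbd j)
  have hLd : ∀ j, MemLp (fun ω => d j * x j ω) 2 P := fun j =>
    ((hL j).const_mul (d j)).mono_exponent le_top
  have hm : ∀ j, Measurable fun ω => d j * x j ω := fun j => (hmeas j).const_mul _
  have hd0 : ∀ j, ∫ ω, d j * x j ω ∂P = 0 := fun j => by rw [integral_const_mul, h0, mul_zero]
  have hsum0 : ∫ ω, ∑ j ∈ t, d j * x j ω ∂P = 0 := by
    rw [integral_finsetSum _ fun j _ => (hLd j).integrable (by norm_num)]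
    exact Finset.sum_eq_zero fun j _ => hd0 j
  have hind' : iIndepFun (fun j ω => d j * x j ω) P :=
    hind.comp (fun j y => d j * y) fun j => measurable_const_mul _
  have hvar := IndepFun.variance_sum (s := t) (X := fun j ω => d j * x j ω) (μ := P)
    (fun j _ => hLd j) fun j _ k _ hjk => hind'.indepFun hjk
  have h1 : (∑ j ∈ t, fun ω => d j * x j ω) = fun ω => ∑ j ∈ t, d j * x j ω := by
    ext ω; simp
  rw [h1, variance_of_integral_eq_zero (Finset.measurable_sum t fun j _ => hm j).aemeasurable
    hsum0] at hvar
  refine hvar.le.trans ?_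
  rw [Finset.mul_sum]
  refine Finset.sum_le_sum fun j _ => ?_
  rw [variance_of_integral_eq_zero (hm j).aemeasurable (hd0 j)]
  simp_rw [mul_pow]
  rw [integral_const_mul, mul_comm]
  refine mul_le_mul_of_nonneg_right ?_ (sq_nonneg _)
  have h2 : Integrable (fun ω => x j ω ^ 2) P := ((hL j).mono_exponent le_top).integrable_sq
  refine (integral_mono_ae h2 (integrable_const (R ^ 2)) ?_).trans (by simp)
  filter_upwards [hbd j] with ω hω
  exact sq_le_sq' (abs_le.1 hω).1 (abs_le.1 hω).2

/-- The second moment of a centred quadratic form in independent bounded centred random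
variables. -/
theorem integral_sq_quadraticForm_le [DecidableEq ι] (hind : iIndepFun x P)
    (hmeas : ∀ j, Measurable (x j))
    (hbd : ∀ j, ∀ᵐ ω ∂P, |x j ω| ≤ R) (h0 : ∀ j, ∫ ω, x j ω ∂P = 0) (s : ι → ℝ)
    (hs : ∀ j, ∫ ω, x j ω ^ 2 ∂P = s j) (b : ι → ι → ℝ) (t : Finset ι) :
    ∫ ω, (∑ j ∈ t, ∑ k ∈ t, x j ω * x k ω * b j k - ∑ j ∈ t, s j * b j j) ^ 2 ∂P ≤
      4 * R ^ 4 * ∑ j ∈ t, ∑ k ∈ t, b j k ^ 2 := by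
  have hL : ∀ j, MemLp (x j) ⊤ P := fun j =>
    memLp_top_of_bound (hmeas j).aestronglyMeasurable R (hbd j)
  have hLsq : ∀ j, MemLp (fun ω => x j ω ^ 2) ⊤ P := fun j => by
    simpa only [pow_two] using MemLp.mul' (r := ⊤) (hL j) (hL j)
  have hsq : ∀ j, ∀ᵐ ω ∂P, x j ω ^ 2 ≤ R ^ 2 := fun j => by
    filter_upwards [hbd j] with ω hω
    exact sq_le_sq' (abs_le.1 hω).1 (abs_le.1 hω).2
  have hs0 : ∀ j, 0 ≤ s j := fun j => by rw [← hs j]; exact integral_nonneg fun _ => sq_nonneg _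
  have hsR : ∀ j, s j ≤ R ^ 2 := fun j => by
    rw [← hs j]
    exact (integral_mono_ae ((hLsq j).integrable le_top) (integrable_const (R ^ 2)) (hsq j)).trans
      (by simp)
  induction t using Finset.induction_on with
  | empty => simp
  | insert a t ha ih =>
    -- A martingale argument: adding the index `a` adds `l * x a + b a a * (x a ^ 2 - s a)`, where
    -- `q` and `l` depend only on the earlier variables. The increment is therefore orthogonal to
    -- `q`, and second moments add up.
    set q : Ω → ℝ := fun ω => ∑ j ∈ t, ∑ k ∈ t, x j ω * x k ω * b j k - ∑ j ∈ t, s j * b j j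
      with hq
    set l : Ω → ℝ := fun ω => ∑ j ∈ t, (b j a + b a j) * x j ω with hl
    have hLq : MemLp q ⊤ P := by
      refine MemLp.sub ?_ (memLp_const _)
      exact memLp_finsetSum _ fun j _ => memLp_finsetSum _ fun k _ =>
        ((MemLp.mul' (r := ⊤) (hL k) (hL j))).mul_const _
    have hLl : MemLp l ⊤ P := memLp_finsetSum _ fun j _ => (hL j).const_mul _
    have hLy : MemLp (fun ω => x a ω ^ 2 - s a) ⊤ P := (hLsq a).sub (memLp_const _)
    have hLinc : MemLp (fun ω => l ω * x a ω + b a a * (x a ω ^ 2 - s a)) ⊤ P :=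
      (MemLp.mul' (r := ⊤) (hL a) hLl).add (hLy.const_mul _)
    have hsplit : ∀ ω, ∑ j ∈ insert a t, ∑ k ∈ insert a t, x j ω * x k ω * b j k -
        ∑ j ∈ insert a t, s j * b j j =
        q ω + (l ω * x a ω + b a a * (x a ω ^ 2 - s a)) := by
      intro ω
      simp only [Finset.sum_insert ha, Finset.sum_add_distrib, hq, hl, Finset.sum_mul, add_mul]
      have e1 : ∑ k ∈ t, x a ω * x k ω * b a k = ∑ k ∈ t, b a k * x k ω * x a ω :=
        Finset.sum_congr rfl fun k _ => by ring
      have e2 : ∑ k ∈ t, x k ω * x a ω * b k a = ∑ k ∈ t, b k a * x k ω * x a ω :=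
        Finset.sum_congr rfl fun k _ => by ring
      rw [e1, e2]
      ring
    have hindep : IndepFun (fun ω (j : t) => x j ω) (x a) P := by
      have h := hind.indepFun_finset t {a} (by simpa using ha) hmeas
      exact h.comp (φ := id) (ψ := fun z : (({a} : Finset ι) → ℝ) => z ⟨a, by simp⟩) measurable_id
        (measurable_pi_apply _)
    have hqfun : ∃ φ : (t → ℝ) → ℝ, Measurable φ ∧ q = fun ω => φ fun j => x j ω := by
      refine ⟨fun z => ∑ j : t, ∑ k : t, z j * z k * b j k - ∑ j ∈ t, s j * b j j, by fun_prop, ?_⟩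
      ext ω
      simp only [hq]
      congr 1
      rw [← Finset.sum_coe_sort t]
      exact Finset.sum_congr rfl fun j _ =>
        (Finset.sum_coe_sort t fun k => x j ω * x k ω * b j k).symm
    have hlfun : ∃ φ : (t → ℝ) → ℝ, Measurable φ ∧ l = fun ω => φ fun j => x j ω := by
      refine ⟨fun z => ∑ j : t, (b j a + b a j) * z j, by fun_prop, ?_⟩
      ext ω
      exact (Finset.sum_coe_sort t fun j => (b j a + b a j) * x j ω).symm
    obtain ⟨φ, hφ, hqφ⟩ := hqfun
    obtain ⟨ψ, hψ, hlψ⟩ := hlfun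
    have hc1 : ∫ ω, q ω * l ω * x a ω ∂P = 0 := by
      have h := (hindep.comp (φ := fun z => φ z * ψ z) (ψ := id) (hφ.mul hψ)
        measurable_id).integral_fun_mul_eq_mul_integral
        (((hφ.mul hψ).comp (measurable_pi_lambda _ fun j => hmeas j)).aestronglyMeasurable)
        (hmeas a).aestronglyMeasurable
      have h' : ∫ ω, q ω * l ω * x a ω ∂P =
          (∫ ω, q ω * l ω ∂P) * ∫ ω, x a ω ∂P := by rw [hqφ, hlψ]; exact h
      rw [h', h0, mul_zero]
    have hy0 : ∫ ω, (x a ω ^ 2 - s a) ∂P = 0 := by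
      rw [integral_sub ((hLsq a).integrable le_top) (integrable_const _), hs]
      simp
    have hc2 : ∫ ω, q ω * (x a ω ^ 2 - s a) ∂P = 0 := by
      have h := (hindep.comp (φ := φ) (ψ := fun y => y ^ 2 - s a) hφ
        (by fun_prop)).integral_fun_mul_eq_mul_integral
        ((hφ.comp (measurable_pi_lambda _ fun j => hmeas j)).aestronglyMeasurable)
        (((hmeas a).pow_const 2).sub_const _).aestronglyMeasurable
      have h' : ∫ ω, q ω * (x a ω ^ 2 - s a) ∂P =
          (∫ ω, q ω ∂P) * ∫ ω, (x a ω ^ 2 - s a) ∂P := by rw [hqφ]; exact h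
      rw [h', hy0, mul_zero]
    have hI1 : Integrable (fun ω => q ω ^ 2) P := (hLq.mono_exponent le_top).integrable_sq
    have hI2 : Integrable (fun ω => (l ω * x a ω + b a a * (x a ω ^ 2 - s a)) ^ 2) P :=
      (hLinc.mono_exponent le_top).integrable_sq
    have hI3 : Integrable (fun ω => q ω * l ω * x a ω) P :=
      (MemLp.mul' (r := ⊤) (hL a) (MemLp.mul' (r := ⊤) hLl hLq)).integrable le_top
    have hI4 : Integrable (fun ω => q ω * (x a ω ^ 2 - s a)) P :=
      (MemLp.mul' (r := ⊤) hLy hLq).integrable le_top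
    have hI5 : Integrable (fun ω => l ω ^ 2) P := (hLl.mono_exponent le_top).integrable_sq
    have hexp : ∫ ω, (q ω + (l ω * x a ω + b a a * (x a ω ^ 2 - s a))) ^ 2 ∂P =
        ∫ ω, q ω ^ 2 ∂P + ∫ ω, (l ω * x a ω + b a a * (x a ω ^ 2 - s a)) ^ 2 ∂P := by
      have : ∀ ω, (q ω + (l ω * x a ω + b a a * (x a ω ^ 2 - s a))) ^ 2 =
          (q ω ^ 2 + (l ω * x a ω + b a a * (x a ω ^ 2 - s a)) ^ 2) +
            (2 * (q ω * l ω * x a ω) + (2 * b a a) * (q ω * (x a ω ^ 2 - s a))) :=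
        fun ω => by ring
      simp_rw [this]
      have hI12 : Integrable (fun ω =>
        q ω ^ 2 + (l ω * x a ω + b a a * (x a ω ^ 2 - s a)) ^ 2) P := hI1.add hI2
      have hI34 : Integrable (fun ω => 2 * (q ω * l ω * x a ω) +
        2 * b a a * (q ω * (x a ω ^ 2 - s a))) P := (hI3.const_mul _).add (hI4.const_mul _)
      rw [integral_add hI12 hI34,
        integral_add hI1 hI2, integral_add (hI3.const_mul _) (hI4.const_mul _),
        integral_const_mul, integral_const_mul, hc1, hc2]
      ring
    have hinc : ∫ ω, (l ω * x a ω + b a a * (x a ω ^ 2 - s a)) ^ 2 ∂P ≤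
        2 * R ^ 2 * ∫ ω, l ω ^ 2 ∂P + 2 * R ^ 4 * b a a ^ 2 := by
      have hmono := integral_mono_ae hI2 ((hI5.const_mul (2 * R ^ 2)).add
        (integrable_const (2 * R ^ 4 * b a a ^ 2))) ?_
      · refine hmono.trans (le_of_eq ?_)
        simp only [Pi.add_apply]
        rw [integral_add (hI5.const_mul _) (integrable_const _), integral_const_mul]
        simp
      · filter_upwards [hsq a] with ω hω
        simp only [Pi.add_apply]
        have h1 : (x a ω ^ 2 - s a) ^ 2 ≤ R ^ 4 := by
          rw [show R ^ 4 = (R ^ 2) ^ 2 by ring]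
          exact sq_le_sq' (by linarith [hsR a, sq_nonneg (x a ω)]) (by linarith [hs0 a])
        have h2 : l ω ^ 2 * x a ω ^ 2 ≤ l ω ^ 2 * R ^ 2 :=
          mul_le_mul_of_nonneg_left hω (sq_nonneg _)
        have h3 : b a a ^ 2 * (x a ω ^ 2 - s a) ^ 2 ≤ b a a ^ 2 * R ^ 4 :=
          mul_le_mul_of_nonneg_left h1 (sq_nonneg _)
        have h4 := sq_nonneg (l ω * x a ω - b a a * (x a ω ^ 2 - s a))
        nlinarith
    have hlin : ∫ ω, l ω ^ 2 ∂P ≤ R ^ 2 * ∑ j ∈ t, (b j a + b a j) ^ 2 :=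
      integral_sq_linearForm_le hind hmeas hbd h0 _ t
    have hsumsq : ∑ j ∈ t, (b j a + b a j) ^ 2 ≤
        2 * (∑ j ∈ t, b j a ^ 2 + ∑ j ∈ t, b a j ^ 2) := by
      rw [← Finset.sum_add_distrib, Finset.mul_sum]
      exact Finset.sum_le_sum fun j _ => by nlinarith [sq_nonneg (b j a - b a j)]
    simp_rw [hsplit]
    rw [hexp]
    simp only [Finset.sum_insert ha, Finset.sum_add_distrib]
    -- Two uses of `(y + z)² ≤ 2 y² + 2 z²`, for the increment and for `b j a + b a j`, produce the
    -- constant `4`.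
    have h5 : 2 * R ^ 2 * ∫ ω, l ω ^ 2 ∂P ≤
        2 * R ^ 2 * (R ^ 2 * (2 * (∑ j ∈ t, b j a ^ 2 + ∑ j ∈ t, b a j ^ 2))) :=
      mul_le_mul_of_nonneg_left (hlin.trans (mul_le_mul_of_nonneg_left hsumsq (sq_nonneg _)))
        (by positivity)
    have h6 : 0 ≤ R ^ 4 * b a a ^ 2 := by positivity
    nlinarith

/-- The complex version of `integral_sq_quadraticForm_le`. -/
theorem lintegral_enorm_sq_quadraticForm_le [DecidableEq ι] [Fintype ι] (hind : iIndepFun x P)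
    (hmeas : ∀ j, Measurable (x j))
    (hbd : ∀ j, ∀ᵐ ω ∂P, |x j ω| ≤ R) (h0 : ∀ j, ∫ ω, x j ω ∂P = 0) (s : ι → ℝ)
    (hs : ∀ j, ∫ ω, x j ω ^ 2 ∂P = s j) (b : ι → ι → ℂ) :
    ∫⁻ ω, ENNReal.ofReal (‖∑ j, ∑ k, (x j ω : ℂ) * (x k ω : ℂ) * b j k -
        ∑ j, (s j : ℂ) * b j j‖ ^ 2) ∂P ≤
      ENNReal.ofReal (4 * R ^ 4 * ∑ j, ∑ k, ‖b j k‖ ^ 2) := by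
  have hL : ∀ j, MemLp (x j) ⊤ P := fun j =>
    memLp_top_of_bound (hmeas j).aestronglyMeasurable R (hbd j)
  have hint : ∀ c : ι → ι → ℝ, Integrable (fun ω =>
      (∑ j, ∑ k, x j ω * x k ω * c j k - ∑ j, s j * c j j) ^ 2) P := fun c => by
    refine (MemLp.mono_exponent (q := ⊤) ?_ le_top).integrable_sq
    refine MemLp.sub ?_ (memLp_const _)
    exact memLp_finsetSum _ fun j _ => memLp_finsetSum _ fun k _ =>
      ((MemLp.mul' (r := ⊤) (hL k) (hL j))).mul_const _
  -- The variables are real, so the real and imaginary parts of `b` give two separate real quadratic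
  -- forms.
  have hnorm : ∀ ω, ‖∑ j, ∑ k, (x j ω : ℂ) * (x k ω : ℂ) * b j k - ∑ j, (s j : ℂ) * b j j‖ ^ 2 =
      (∑ j, ∑ k, x j ω * x k ω * (b j k).re - ∑ j, s j * (b j j).re) ^ 2 +
        (∑ j, ∑ k, x j ω * x k ω * (b j k).im - ∑ j, s j * (b j j).im) ^ 2 := by
    intro ω
    rw [← Complex.normSq_eq_norm_sq, Complex.normSq_apply, ← pow_two, ← pow_two]
    simp only [Complex.sub_re, Complex.sub_im, Complex.re_sum, Complex.im_sum,
      ← Complex.ofReal_mul, Complex.re_ofReal_mul, Complex.im_ofReal_mul]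
  simp_rw [hnorm]
  have hadd : Integrable (fun ω =>
      (∑ j, ∑ k, x j ω * x k ω * (b j k).re - ∑ j, s j * (b j j).re) ^ 2 +
        (∑ j, ∑ k, x j ω * x k ω * (b j k).im - ∑ j, s j * (b j j).im) ^ 2) P :=
    (hint fun j k => (b j k).re).add (hint fun j k => (b j k).im)
  rw [← ofReal_integral_eq_lintegral_ofReal hadd (Eventually.of_forall fun ω => by positivity)]
  refine ENNReal.ofReal_le_ofReal ?_
  rw [integral_add (hint fun j k => (b j k).re) (hint fun j k => (b j k).im)]
  refine (add_le_add
    (integral_sq_quadraticForm_le hind hmeas hbd h0 s hs (fun j k => (b j k).re) Finset.univ)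
    (integral_sq_quadraticForm_le hind hmeas hbd h0 s hs (fun j k => (b j k).im)
      Finset.univ)).trans (le_of_eq ?_)
  rw [← mul_add, ← Finset.sum_add_distrib]
  simp_rw [← Finset.sum_add_distrib, ← Complex.normSq_eq_norm_sq, Complex.normSq_apply, ← pow_two]

end QuadraticForm

/-! ### Random matrices with a variance profile -/

/-- Integration of a function of two independent random variables, one after the other. -/
theorem lintegral_le_of_indepFun {Ω α β : Type*} [MeasurableSpace Ω] [MeasurableSpace α]
    [MeasurableSpace β] {P : Measure Ω} [IsProbabilityMeasure P] {X : Ω → α} {Y : Ω → β}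
    (hX : Measurable X) (hY : Measurable Y) (hXY : IndepFun X Y P) {F : α → β → ENNReal}
    (hF : Measurable (Function.uncurry F)) {c : ENNReal}
    (h : ∀ ω', ∫⁻ ω, F (X ω) (Y ω') ∂P ≤ c) : ∫⁻ ω, F (X ω) (Y ω) ∂P ≤ c := by
  have h1 : ∫⁻ ω, F (X ω) (Y ω) ∂P =
      ∫⁻ p, Function.uncurry F p ∂(P.map fun ω => (X ω, Y ω)) := by
    rw [lintegral_map hF (hX.prodMk hY)]
    rfl
  have := Measure.isProbabilityMeasure_map (μ := P) hX.aemeasurable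
  have := Measure.isProbabilityMeasure_map (μ := P) hY.aemeasurable
  have hF' : Measurable fun y => ∫⁻ x, Function.uncurry F (x, y) ∂(P.map X) :=
    hF.lintegral_prod_left'
  rw [h1, hXY.map_prod_eq_prod_map_map hX.aemeasurable hY.aemeasurable,
    lintegral_prod_symm' _ hF, lintegral_map hF' hY]
  refine (lintegral_mono fun ω' => ?_).trans (by simp : ∫⁻ _, c ∂P ≤ c)
  have hF'' : Measurable fun x => Function.uncurry F (x, Y ω') := by fun_prop
  rw [lintegral_map hF'' hX]
  exact h ω'

/-- `A` is a symmetric random matrix whose entries on and above the diagonal are independent,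
centred, bounded by `R`, and have variances `s i j`. -/
structure IsWignerType {Ω : Type*} [MeasurableSpace Ω] (P : Measure Ω) {n : ℕ}
    (s : Fin n → Fin n → ℝ) (R : ℝ) (A : Ω → Matrix (Fin n) (Fin n) ℝ) : Prop where
  isHermitian : ∀ ω, (A ω).IsHermitian
  measurable : ∀ i j, Measurable fun ω => A ω i j
  indep : iIndepFun
    (fun (p : {p : Fin n × Fin n // p.1 ≤ p.2}) (ω : Ω) => A ω p.1.1 p.1.2) P
  integral_eq_zero : ∀ i j, ∫ ω, A ω i j ∂P = 0
  integral_sq : ∀ i j, ∫ ω, A ω i j ^ 2 ∂P = s i j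
  bounded : ∀ i j, ∀ᵐ ω ∂P, |A ω i j| ≤ R

/-- The position on or above the diagonal that is symmetric or equal to `(i, j)`. -/
def upperPair {n : ℕ} (i j : Fin n) : {p : Fin n × Fin n // p.1 ≤ p.2} :=
  ⟨(min i j, max i j), min_le_max⟩

namespace IsWignerType

variable {Ω : Type*} [MeasurableSpace Ω] {P : Measure Ω} {n : ℕ}
  {s : Fin n → Fin n → ℝ} {R : ℝ} {A : Ω → Matrix (Fin n) (Fin n) ℝ}

theorem symm (hA : IsWignerType P s R A) (ω : Ω) (i j : Fin n) : A ω i j = A ω j i := by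
  simpa using (hA.isHermitian ω).apply j i

theorem apply_upperPair (hA : IsWignerType P s R A) (ω : Ω) (i j : Fin n) :
    A ω (upperPair i j).1.1 (upperPair i j).1.2 = A ω i j := by
  rcases le_total i j with h | h
  · simp [upperPair, h]
  · simp [upperPair, h, hA.symm ω i j]

theorem variance_symm (hA : IsWignerType P s R A) (i j : Fin n) : s i j = s j i := by
  rw [← hA.integral_sq, ← hA.integral_sq]
  simp_rw [hA.symm _ i j]

theorem variance_nonneg (hA : IsWignerType P s R A) (i j : Fin n) : 0 ≤ s i j := by
  rw [← hA.integral_sq]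
  exact integral_nonneg fun _ => sq_nonneg _

theorem variance_le [IsProbabilityMeasure P] (hA : IsWignerType P s R A) (i j : Fin n) :
    s i j ≤ R ^ 2 := by
  rw [← hA.integral_sq]
  have hL : MemLp (fun ω => A ω i j) 2 P :=
    (memLp_top_of_bound (hA.measurable i j).aestronglyMeasurable R (hA.bounded i j)).mono_exponent
      le_top
  refine (integral_mono_ae hL.integrable_sq (integrable_const (R ^ 2)) ?_).trans (by simp)
  filter_upwards [hA.bounded i j] with ω hω
  exact sq_le_sq' (abs_le.1 hω).1 (abs_le.1 hω).2

theorem iIndepFun_offDiagRow (hA : IsWignerType P s R A) (i : Fin n) :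
    iIndepFun (fun j ω => offDiagRow (A ω) i j) P := by
  have hinj : Function.Injective fun j => upperPair i j := by
    intro j k hjk
    simp only [upperPair, Subtype.mk.injEq, Prod.mk.injEq] at hjk
    grind
  have h := (hA.indep.precomp hinj).comp (fun j y => if j = i then 0 else y)
    fun j => by split_ifs <;> fun_prop
  convert h using 3 with j ω
  simp [offDiagRow, hA.apply_upperPair]

theorem measurable_deleteRowCol (hA : IsWignerType P s R A) (i : Fin n) :
    Measurable fun ω j k => deleteRowCol (A ω) i j k := by
  refine measurable_pi_lambda _ fun j => measurable_pi_lambda _ fun k => ?_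
  simp only [deleteRowCol, Matrix.of_apply]
  split_ifs
  · exact measurable_const
  · exact hA.measurable j k

theorem measurable_offDiagRow (hA : IsWignerType P s R A) (i j : Fin n) :
    Measurable fun ω => offDiagRow (A ω) i j := by
  simp only [offDiagRow]
  split_ifs
  · exact measurable_const
  · exact hA.measurable i j

/-- The row uses only positions meeting the index `i`, the remaining matrix only positions avoiding
it; these are disjoint sets of independent entries. -/
theorem indepFun_offDiagRow_deleteRowCol (hA : IsWignerType P s R A) (i : Fin n) :
    IndepFun (fun ω j => offDiagRow (A ω) i j)
      (fun ω j k => deleteRowCol (A ω) i j k) P := by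
  classical
  set S : Finset {p : Fin n × Fin n // p.1 ≤ p.2} :=
    Finset.univ.filter fun p => p.1.1 = i ∨ p.1.2 = i with hS
  have h := hA.indep.indepFun_finset S Sᶜ disjoint_compl_right fun p => hA.measurable _ _
  have hmemS : ∀ j, upperPair i j ∈ S := fun j => by
    simp only [hS, upperPair, Finset.mem_filter, Finset.mem_univ, true_and]
    grind
  have hmemT : ∀ j k, ¬(j = i ∨ k = i) → upperPair j k ∈ Sᶜ := fun j k hjk => by
    simp only [hS, upperPair, Finset.mem_compl, Finset.mem_filter, Finset.mem_univ, true_and]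
    grind
  let φ : (S → ℝ) → Fin n → ℝ := fun z j => if j = i then 0 else z ⟨upperPair i j, hmemS j⟩
  let ψ : ((Sᶜ : Finset _) → ℝ) → Fin n → Fin n → ℝ := fun z j k =>
    if hjk : j = i ∨ k = i then 0 else z ⟨upperPair j k, hmemT j k hjk⟩
  have hφ : Measurable φ := measurable_pi_lambda _ fun j => by
    simp only [φ]; split_ifs <;> fun_prop
  have hψ : Measurable ψ := measurable_pi_lambda _ fun j => measurable_pi_lambda _ fun k => by
    simp only [ψ]; split_ifs <;> fun_prop
  have h2 := h.comp hφ hψ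
  convert h2 using 1
  · ext ω j
    simp [φ, offDiagRow, hA.apply_upperPair]
  · ext ω j k
    simp [ψ, deleteRowCol, hA.apply_upperPair]

end IsWignerType

/-- The inverse is the adjugate divided by the determinant, both continuous in the entries. Scalar
inversion is measurable even at `0`, so singular matrices need no separate treatment. -/
theorem measurable_resolventMatrix {ι : Type*} [Fintype ι] [DecidableEq ι] (η : ℝ) (j k : ι) :
    Measurable fun y : ι → ι → ℝ => resolventMatrix (Matrix.of y) η j k := by
  have hc : Continuous fun y : ι → ι → ℝ => shiftedMatrix (Matrix.of y) η := by
    refine continuous_matrix fun a b => ?_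
    simp only [shiftedMatrix, Matrix.sub_apply, Matrix.map_apply, Matrix.of_apply]
    fun_prop
  simp only [resolventMatrix, Matrix.inv_def, Ring.inverse_eq_inv', Matrix.smul_apply, smul_eq_mul]
  exact (hc.matrix_det.measurable.inv).mul (hc.matrix_adjugate.matrix_elem j k).measurable

namespace IsWignerType

variable {Ω : Type*} [MeasurableSpace Ω] {P : Measure Ω} {n : ℕ}
  {s : Fin n → Fin n → ℝ} {R : ℝ} {A : Ω → Matrix (Fin n) (Fin n) ℝ}

theorem measurable_schurError (hA : IsWignerType P s R A) (η : ℝ) (i : Fin n) :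
    Measurable fun ω => schurError s (A ω) η i := by
  have hres : ∀ j k, Measurable fun ω => resolventMatrix (deleteRowCol (A ω) i) η j k :=
    fun j k => (measurable_resolventMatrix η j k).comp (hA.measurable_deleteRowCol i)
  have ha : ∀ j, Measurable fun ω => (offDiagRow (A ω) i j : ℂ) :=
    fun j => Complex.measurable_ofReal.comp (hA.measurable_offDiagRow i j)
  refine Measurable.sub ?_ ?_
  · exact Finset.measurable_sum _ fun j _ => Finset.measurable_sum _ fun k _ =>
      ((ha j).mul (ha k)).mul (hres j k)
  · exact Finset.measurable_sum _ fun j _ => (hres j j).const_mul _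

variable [IsProbabilityMeasure P]

/-- The second moment of the fluctuation in the Schur complement formula. -/
theorem lintegral_schurError_sq_le (hA : IsWignerType P s R A) {η : ℝ} (hη : 0 < η) (i : Fin n) :
    ∫⁻ ω, ENNReal.ofReal (‖schurError s (A ω) η i‖ ^ 2) ∂P ≤
      ENNReal.ofReal (4 * R ^ 4 * (n * (η⁻¹) ^ 2)) := by
  set s' : Fin n → ℝ := fun j => if j = i then 0 else s i j with hs'
  let F : (Fin n → ℝ) → (Fin n → Fin n → ℝ) → ENNReal := fun a y =>
    ENNReal.ofReal (‖∑ j, ∑ k, (a j : ℂ) * (a k : ℂ) * resolventMatrix (Matrix.of y) η j k -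
      ∑ j, (s' j : ℂ) * resolventMatrix (Matrix.of y) η j j‖ ^ 2)
  have hF : Measurable (Function.uncurry F) := by
    have hres : ∀ j k, Measurable fun p : (Fin n → ℝ) × (Fin n → Fin n → ℝ) =>
        resolventMatrix (Matrix.of p.2) η j k := fun j k =>
      (measurable_resolventMatrix η j k).comp measurable_snd
    have ha : ∀ j, Measurable fun p : (Fin n → ℝ) × (Fin n → Fin n → ℝ) => (p.1 j : ℂ) :=
      fun j => by fun_prop
    refine ENNReal.measurable_ofReal.comp (Measurable.pow_const (Measurable.norm ?_) 2)
    refine Measurable.sub ?_ ?_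
    · exact Finset.measurable_sum _ fun j _ => Finset.measurable_sum _ fun k _ =>
        ((ha j).mul (ha k)).mul (hres j k)
    · exact Finset.measurable_sum _ fun j _ => (hres j j).const_mul _
  refine lintegral_le_of_indepFun (measurable_pi_lambda _ fun j => hA.measurable_offDiagRow i j)
    (hA.measurable_deleteRowCol i) (hA.indepFun_offDiagRow_deleteRowCol i) hF fun ω' => ?_
  have hR : 0 ≤ R := by
    obtain ⟨ω, hω⟩ := (hA.bounded i i).exists
    exact (abs_nonneg _).trans hω
  refine (lintegral_enorm_sq_quadraticForm_le (R := R) (hA.iIndepFun_offDiagRow i)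
    (hA.measurable_offDiagRow i) (fun j => ?_) (fun j => ?_) s' (fun j => ?_)
    (resolventMatrix (deleteRowCol (A ω') i) η)).trans (ENNReal.ofReal_le_ofReal ?_)
  · filter_upwards [hA.bounded i j] with ω hω
    simp only [offDiagRow]
    split_ifs
    · simpa using hR
    · exact hω
  · by_cases hj : j = i
    · simp [offDiagRow, hj]
    · simpa [offDiagRow, hj] using hA.integral_eq_zero i j
  · by_cases hj : j = i
    · simp [offDiagRow, hj, hs']
    · simpa [offDiagRow, hj, hs'] using hA.integral_sq i j
  · refine mul_le_mul_of_nonneg_left ?_ (by positivity)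
    -- Summed by columns: each of the `n` columns contributes at most `η⁻²`.
    rw [Finset.sum_comm]
    refine (Finset.sum_le_sum fun k _ => sum_norm_sq_resolventMatrix_le
      (isHermitian_deleteRowCol (hA.isHermitian ω') i) hη k).trans (by simp)

end IsWignerType

/-! ### The semicircle law for variance profiles -/

theorem isProbabilityMeasure_esd {n : ℕ} (hn : n ≠ 0) {A : Matrix (Fin n) (Fin n) ℝ}
    (hA : A.IsHermitian) : IsProbabilityMeasure (esd hA) := by
  refine ⟨?_⟩
  simp [esd, ENNReal.inv_mul_cancel, hn]

/-- For `n = 0` the spectral measure is zero rather than a probability measure, which is why total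
mass one is only required eventually. -/
theorem isFiniteMeasure_esd {n : ℕ} {A : Matrix (Fin n) (Fin n) ℝ} (hA : A.IsHermitian) :
    IsFiniteMeasure (esd hA) := by
  rcases eq_or_ne n 0 with rfl | hn
  · have : esd hA = 0 := by simp [esd]
    rw [this]
    infer_instance
  · have := isProbabilityMeasure_esd hn hA
    infer_instance

theorem integral_esd {n : ℕ} {A : Matrix (Fin n) (Fin n) ℝ} (hA : A.IsHermitian) (f : ℝ → ℂ) :
    ∫ x, f x ∂(esd hA) = (n : ℂ)⁻¹ * ∑ i, f (hA.eigenvalues i) := by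
  rw [esd, integral_smul_measure, integral_finsetSum_measure fun i _ => integrable_dirac (by simp)]
  simp [integral_dirac]

theorem integral_resolvent_esd {n : ℕ} {A : Matrix (Fin n) (Fin n) ℝ} (hA : A.IsHermitian)
    {η : ℝ} (hη : 0 < η) :
    ∫ x : ℝ, ((x : ℂ) - Complex.I * η)⁻¹ ∂(esd hA) = (n : ℂ)⁻¹ * (resolventMatrix A η).trace := by
  rw [integral_esd, trace_resolventMatrix hA hη]

theorem VanishesInProbability.of_lintegral {Ω : ℕ → Type*} [∀ n, MeasurableSpace (Ω n)]
    {P : ∀ n, Measure (Ω n)} {e : ∀ n, Ω n → ℝ} (he : ∀ n, Measurable (e n))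
    (h : Tendsto (fun n => ∫⁻ ω, ENNReal.ofReal ‖e n ω‖ ∂(P n)) atTop (𝓝 0)) :
    VanishesInProbability P e := by
  intro ε hε
  have hε' : ENNReal.ofReal ε ≠ 0 := by simpa using hε
  have hlim : Tendsto (fun n => (∫⁻ ω, ENNReal.ofReal ‖e n ω‖ ∂(P n)) / ENNReal.ofReal ε) atTop
      (𝓝 0) := by
    simpa using ENNReal.Tendsto.div_const h (Or.inr hε')
  refine tendsto_of_tendsto_of_tendsto_of_le_of_le tendsto_const_nhds hlim (fun _ => zero_le)
    fun n => ?_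
  refine le_trans (measure_mono fun ω hω => ?_)
    (meas_ge_le_lintegral_div (he n).norm.ennreal_ofReal.aemeasurable hε' ENNReal.ofReal_ne_top)
  exact ENNReal.ofReal_le_ofReal hω

theorem lintegral_ofReal_average_le {Ω : Type*} [MeasurableSpace Ω] {P : Measure Ω} {n : ℕ}
    {f : Fin n → Ω → ℝ} (hf : ∀ i, Measurable (f i)) (h0 : ∀ i ω, 0 ≤ f i ω) {B : ℝ} (hB : 0 ≤ B)
    (h : ∀ i, ∫⁻ ω, ENNReal.ofReal (f i ω) ∂P ≤ ENNReal.ofReal B) :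
    ∫⁻ ω, ENNReal.ofReal ((n : ℝ)⁻¹ * ∑ i, f i ω) ∂P ≤ ENNReal.ofReal B := by
  have hn : (0 : ℝ) ≤ (n : ℝ)⁻¹ := by positivity
  simp_rw [ENNReal.ofReal_mul hn, ENNReal.ofReal_sum_of_nonneg fun i _ => h0 i _]
  rw [lintegral_const_mul _ (Finset.measurable_sum _ fun i _ => (hf i).ennreal_ofReal),
    lintegral_finsetSum _ fun i _ => (hf i).ennreal_ofReal]
  refine (mul_le_mul_right (Finset.sum_le_sum fun i _ => h i) _).trans ?_
  rw [Finset.sum_const, Finset.card_univ, Fintype.card_fin, nsmul_eq_mul, ← mul_assoc,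
    ← ENNReal.ofReal_natCast, ← ENNReal.ofReal_mul hn, ← ENNReal.ofReal_mul (by positivity)]
  refine ENNReal.ofReal_le_ofReal ?_
  rcases eq_or_ne n 0 with rfl | hn0
  · simpa using hB
  · rw [inv_mul_cancel₀ (by exact_mod_cast hn0), one_mul]

/-- The semicircle law for symmetric random matrices with a variance profile: independent centred
entries of order `n^{-1/2}` whose variances sum up to approximately `v` in every row. -/
theorem tendstoWeaklyInProbability_semicircleLaw {Ω : ℕ → Type*} [∀ n, MeasurableSpace (Ω n)]
    {P : ∀ n, Measure (Ω n)} [∀ n, IsProbabilityMeasure (P n)]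
    {s : ∀ n, Fin n → Fin n → ℝ} {C v : ℝ} (hC : 0 ≤ C) (hv : 0 ≤ v)
    {A : ∀ n, Ω n → Matrix (Fin n) (Fin n) ℝ}
    (hA : ∀ n, IsWignerType (P n) (s n) (C / √(n : ℝ)) (A n))
    (hrow : ∀ δ : ℝ, 0 < δ → ∀ᶠ n in atTop, ∀ i, |∑ j, s n i j - v| ≤ δ) :
    TendstoWeaklyInProbability P (fun n ω => esd ((hA n).isHermitian ω)) (semicircleLaw v) := by
  have := isProbabilityMeasure_semicircleLaw hv
  have hfin : ∀ n ω, IsFiniteMeasure (esd ((hA n).isHermitian ω)) :=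
    fun n ω => isFiniteMeasure_esd _
  -- Since `2 (v + 1) ≥ 1`, every `η ≥ 2 (v + 1)` satisfies the contraction condition `η² ≥ 2 (v +
  -- 1)`.
  refine tendstoWeaklyInProbability_of_resolvent (η₀ := 2 * (v + 1))
    ((eventually_ne_atTop 0).mono fun n hn ω => isProbabilityMeasure_esd hn _) (by positivity)
    fun η hη => ?_
  have hη0 : 0 < η := by linarith
  have hηv : 2 * (v + 1) ≤ η ^ 2 := by nlinarith
  refine VanishesInProbability.of_forall_approx (F := ℝ) fun τ' hτ' => ?_
  -- The tolerance `τ'` is split into four quarters. The value of `τ` makes `c * τ` one of them,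
  -- where `c` is the prefactor of the trace bound and `τ` enters through `y ≤ τ + y² / τ`.
  set τ : ℝ := τ' * η ^ 2 / 8 with hτdef
  have hτ : 0 < τ := by positivity
  set c : ℝ := 2 * (η⁻¹) ^ 2 with hc
  have hc0 : 0 ≤ c := by positivity
  have hcτ : c * τ = τ' / 4 := by
    rw [hc, hτdef]
    field_simp
    norm_num
  set f : ∀ n, Fin n → Ω n → ℝ := fun n i ω =>
    c * |A n ω i i| + c / τ * ‖schurError (s n) (A n ω) η i‖ ^ 2 with hf
  have hf0 : ∀ n i ω, 0 ≤ f n i ω := fun n i ω => by positivity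
  have hfm1 : ∀ n i, Measurable fun ω => c * |A n ω i i| := fun n i =>
    (((hA n).measurable i i).norm).const_mul c
  have hfm2 : ∀ n i, Measurable fun ω => c / τ * ‖schurError (s n) (A n ω) η i‖ ^ 2 :=
    fun n i => ((((hA n).measurable_schurError η i).norm).pow_const 2).const_mul _
  have hfm : ∀ n i, Measurable (f n i) := fun n i => (hfm1 n i).add (hfm2 n i)
  refine ⟨fun n ω => (n : ℝ)⁻¹ * ∑ i, f n i ω, ?_, ?_⟩
  · refine VanishesInProbability.of_lintegral (fun n => (Finset.measurable_sum _ fun i _ =>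
      hfm n i).const_mul _) ?_
    -- With entries of size `C / √n`, the second moment of the Schur error is of order `n * (C / √n)
    -- ^ 4 = C ^ 4 / n`.
    set B : ℕ → ℝ := fun n => c * (C / √(n : ℝ)) +
      c / τ * (4 * (C / √(n : ℝ)) ^ 4 * (n * (η⁻¹) ^ 2)) with hB
    have hB0 : ∀ n, 0 ≤ B n := fun n => by positivity
    have hBlim : Tendsto B atTop (𝓝 0) := by
      have h1 : Tendsto (fun n : ℕ => C / √(n : ℝ)) atTop (𝓝 0) :=
        tendsto_const_nhds.div_atTop
          (Real.tendsto_sqrt_atTop.comp tendsto_natCast_atTop_atTop)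
      have h2 : Tendsto (fun n : ℕ => c * (C / √(n : ℝ)) +
          c / τ * (4 * (C ^ 2 * (C / √(n : ℝ)) ^ 2) * (η⁻¹) ^ 2)) atTop (𝓝 0) := by
        have h3 := (h1.const_mul c).add
          (((((h1.pow 2).const_mul (C ^ 2)).const_mul 4).mul_const ((η⁻¹) ^ 2)).const_mul (c / τ))
        simpa using h3
      refine h2.congr' ((eventually_ne_atTop 0).mono fun n hn => ?_)
      have hn' : (0 : ℝ) < n := by positivity
      have hsq : √(n : ℝ) ^ 2 = n := Real.sq_sqrt hn'.le
      have hs0 : √(n : ℝ) ≠ 0 := (Real.sqrt_pos.2 hn').ne'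
      have h4 : (C / √(n : ℝ)) ^ 4 * n = C ^ 2 * (C / √(n : ℝ)) ^ 2 := by
        rw [div_pow, div_pow, show √(n : ℝ) ^ 4 = (√(n : ℝ) ^ 2) ^ 2 by ring, hsq]
        field_simp
      simp only [hB]
      rw [← h4]
      ring
    refine tendsto_of_tendsto_of_tendsto_of_le_of_le tendsto_const_nhds
      (by simpa only [ENNReal.ofReal_zero] using ENNReal.tendsto_ofReal hBlim :
        Tendsto (fun n => ENNReal.ofReal (B n)) atTop (𝓝 0)) (fun _ => zero_le) fun n => ?_
    have hnn : ∀ ω, ‖(n : ℝ)⁻¹ * ∑ i, f n i ω‖ = (n : ℝ)⁻¹ * ∑ i, f n i ω := fun ω =>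
      Real.norm_of_nonneg (mul_nonneg (by positivity) (Finset.sum_nonneg fun i _ => hf0 n i ω))
    simp only [hnn]
    refine lintegral_ofReal_average_le (hfm n) (hf0 n) (hB0 n)
      fun i => ?_
    have hsplit : ∀ ω, ENNReal.ofReal (f n i ω) = ENNReal.ofReal (c * |A n ω i i|) +
        ENNReal.ofReal (c / τ) * ENNReal.ofReal (‖schurError (s n) (A n ω) η i‖ ^ 2) := fun ω => by
      rw [← ENNReal.ofReal_mul (by positivity), ← ENNReal.ofReal_add (by positivity)
        (by positivity)]
    rw [lintegral_congr hsplit, lintegral_add_left (hfm1 n i).ennreal_ofReal, lintegral_const_mul _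
      ((((hA n).measurable_schurError η i).norm).pow_const 2).ennreal_ofReal,
      hB, ENNReal.ofReal_add (by positivity) (by positivity),
      ENNReal.ofReal_mul (p := c / τ) (by positivity)]
    refine add_le_add ?_ (mul_le_mul_right ((hA n).lintegral_schurError_sq_le hη0 i) _)
    refine (lintegral_mono_ae (g := fun _ => ENNReal.ofReal (c * (C / √(n : ℝ)))) ?_).trans
      (by simp)
    filter_upwards [(hA n).bounded i i] with ω hω
    exact ENNReal.ofReal_le_ofReal (mul_le_mul_of_nonneg_left hω hc0)
  · set δ : ℝ := min 1 (τ' / (4 * (c * η⁻¹))) with hδ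
    have hc' : 0 < c * η⁻¹ := by positivity
    have hδ0 : 0 < δ := by positivity
    have hcδ : c * (δ * η⁻¹) ≤ τ' / 4 := by
      have : δ ≤ τ' / (4 * (c * η⁻¹)) := min_le_right _ _
      rw [le_div_iff₀ (by positivity)] at this
      linarith
    have hSlim : Tendsto (fun n : ℕ => c * (2 * (C / √(n : ℝ)) ^ 2 * η⁻¹)) atTop (𝓝 0) := by
      have h1 : Tendsto (fun n : ℕ => C / √(n : ℝ)) atTop (𝓝 0) :=
        tendsto_const_nhds.div_atTop
          (Real.tendsto_sqrt_atTop.comp tendsto_natCast_atTop_atTop)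
      simpa using ((((h1.pow 2).const_mul 2).mul_const η⁻¹).const_mul c)
    filter_upwards [hrow δ hδ0, eventually_ne_atTop 0,
      hSlim.eventually_le_const (show (0 : ℝ) < τ' / 4 by positivity)] with n hn hn0 hS ω
    have hn' : (0 : ℝ) < n := by positivity
    have hnn : ‖(n : ℝ)⁻¹ * ∑ i, f n i ω‖ = (n : ℝ)⁻¹ * ∑ i, f n i ω :=
      Real.norm_of_nonneg (mul_nonneg (by positivity) (Finset.sum_nonneg fun i _ => hf0 n i ω))
    have htr := norm_trace_resolventMatrix_sub_le ((hA n).isHermitian ω) hη0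
      (hA n).variance_nonneg (hA n).variance_le (hA n).variance_symm hn (min_le_left _ _) hηv
      (semicircleTransform_mul hv hη0) (norm_semicircleTransform_le hv hη0)
    -- The three deterministic quarters come from the row sums `δ`, from `τ`, and from the variance
    -- bound `S = (C / √n) ^ 2`; the rest is the random majorant `f`.
    have hterm : c * ∑ i, (δ * η⁻¹ + |A n ω i i| + ‖schurError (s n) (A n ω) η i‖ +
        2 * (C / √(n : ℝ)) ^ 2 * η⁻¹) ≤ ∑ i, f n i ω + n * (3 * (τ' / 4)) := by
      have hconst : (n : ℝ) * (3 * (τ' / 4)) = ∑ _i : Fin n, 3 * (τ' / 4) := by simp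
      rw [hconst, ← Finset.sum_add_distrib, Finset.mul_sum]
      refine Finset.sum_le_sum fun i _ => ?_
      have h1 : ‖schurError (s n) (A n ω) η i‖ ≤
          τ + ‖schurError (s n) (A n ω) η i‖ ^ 2 / τ := by
        set y := ‖schurError (s n) (A n ω) η i‖
        rw [← sub_le_iff_le_add', le_div_iff₀ hτ]
        nlinarith [sq_nonneg (y - τ)]
      have h2 := mul_le_mul_of_nonneg_left h1 hc0
      have h3 : f n i ω = c * |A n ω i i| +
          c * (‖schurError (s n) (A n ω) η i‖ ^ 2 / τ) := by
        simp only [hf]; ring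
      rw [h3]
      linarith
    rw [integral_resolvent_esd _ hη0, hnn]
    change ‖_ - semicircleTransform v η‖ ≤ _
    have hnC : (n : ℂ) ≠ 0 := by exact_mod_cast hn0
    have hfac : (n : ℂ)⁻¹ * (resolventMatrix (A n ω) η).trace - semicircleTransform v η =
        (n : ℂ)⁻¹ * ((resolventMatrix (A n ω) η).trace -
          Fintype.card (Fin n) * semicircleTransform v η) := by
      rw [Fintype.card_fin]
      field_simp
    rw [hfac, norm_mul, norm_inv, Complex.norm_natCast]
    refine (mul_le_mul_of_nonneg_left (htr.trans hterm) (by positivity)).trans ?_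
    rw [mul_add, ← mul_assoc (n : ℝ)⁻¹ (n : ℝ), inv_mul_cancel₀ hn'.ne']
    linarith

/-! ### Proportions of the parts and the multipartite variance profile -/

section Multipartite

theorem proportion_nonneg {n m : ℕ} (κ : Fin n → Fin m) (k : Fin m) : 0 ≤ proportion κ k := by
  unfold proportion; positivity

theorem sum_proportion {n m : ℕ} (hn : n ≠ 0) (κ : Fin n → Fin m) :
    ∑ k, proportion κ k = 1 := by
  have h := Finset.card_eq_sum_card_fiberwise (f := κ) (s := Finset.univ) (t := Finset.univ)
    fun _ _ => by simp
  rw [Finset.card_univ, Fintype.card_fin] at h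
  simp only [proportion]
  rw [← Finset.sum_div, ← Nat.cast_sum, ← h, div_self (by exact_mod_cast hn)]

theorem proportion_le_maxProportion {n m : ℕ} (κ : Fin n → Fin m) (k : Fin m) :
    proportion κ k ≤ maxProportion κ :=
  le_ciSup (Set.finite_range _).bddAbove k

theorem proportion_le_one {n m : ℕ} (κ : Fin n → Fin m) (k : Fin m) : proportion κ k ≤ 1 := by
  unfold proportion
  refine div_le_one_of_le₀ ?_ (by positivity)
  exact_mod_cast (Finset.card_le_univ _).trans (by simp)

/-- In the balanced case all proportions converge uniformly to a common limit. -/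
theorem AsymptoticallyBalanced.exists_tendsto {m : ℕ → ℕ} (hm : ∀ n, 2 ≤ m n)
    {κ : ∀ n, Fin n → Fin (m n)} (h : AsymptoticallyBalanced κ) :
    ∃ l : ℝ, 0 < l ∧ ∀ ε : ℝ, 0 < ε → ∀ᶠ n in atTop, ∀ k, |proportion (κ n) k - l| ≤ ε := by
  obtain ⟨⟨l, hl, hmax⟩, hratio⟩ := h
  refine ⟨l, hl, fun ε hε => ?_⟩
  filter_upwards [hratio (ε / 2) (by positivity), hmax.eventually_const_lt hl,
    Metric.tendsto_nhds.1 hmax (ε / 2) (by positivity)] with n h1 h2 h3 k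
  have : Nonempty (Fin (m n)) := ⟨⟨0, by linarith [hm n]⟩⟩
  -- Comparison with a part `j` of maximal proportion; as this proportion is positive and at most
  -- one, closeness of ratios becomes closeness of differences.
  obtain ⟨j, hj⟩ := exists_eq_ciSup_of_finite (f := proportion (κ n))
  have hj' : proportion (κ n) j = maxProportion (κ n) := hj
  rw [Real.dist_eq, ← hj'] at h3
  rw [← hj'] at h2
  have h4 := h1 k j
  have h5 : proportion (κ n) k - proportion (κ n) j =
      (proportion (κ n) k / proportion (κ n) j - 1) * proportion (κ n) j := by
    field_simp
  have h6 : |proportion (κ n) k - proportion (κ n) j| ≤ ε / 2 := by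
    rw [h5, abs_mul, abs_of_pos h2]
    exact (mul_le_of_le_one_right (abs_nonneg _) (proportion_le_one _ _)).trans h4.le
  calc |proportion (κ n) k - l| ≤ _ := abs_sub_le _ (proportion (κ n) j) _
    _ ≤ ε := by linarith

/-- If all proportions converge uniformly to a positive limit, then the number of parts is
eventually the inverse of this limit. -/
theorem exists_eventually_eq_of_tendsto_proportion {m : ℕ → ℕ} {κ : ∀ n, Fin n → Fin (m n)}
    {l : ℝ} (hl : 0 < l)
    (h : ∀ ε : ℝ, 0 < ε → ∀ᶠ n in atTop, ∀ k, |proportion (κ n) k - l| ≤ ε) :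
    ∃ M : ℕ, (∀ᶠ n in atTop, m n = M) ∧ (M : ℝ) * l = 1 := by
  -- The proportions add up to one, so `m n * l - 1` is minus the sum of the deviations.
  have hbound : ∀ ε : ℝ, 0 < ε → ∀ᶠ n in atTop, |(m n : ℝ) * l - 1| ≤ m n * ε := by
    intro ε hε
    filter_upwards [h ε hε, eventually_ne_atTop 0] with n hn hn0
    have h1 : (m n : ℝ) * l - 1 = -∑ k, (proportion (κ n) k - l) := by
      rw [Finset.sum_sub_distrib, sum_proportion hn0]
      simp
    rw [h1, abs_neg]
    refine (Finset.abs_sum_le_sum_abs _ _).trans ((Finset.sum_le_sum fun k _ => hn k).trans ?_)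
    simp
  -- Taking `ε = l / 2` first bounds `m n * l` by `2`; then `ε = l ^ 2 / 8` gives `l / 4`. Two
  -- values of `m n * l` thus differ by at most `l / 2 < l`, which forces the integers to agree.
  have hclose : ∀ᶠ n in atTop, |(m n : ℝ) * l - 1| ≤ l / 4 := by
    filter_upwards [hbound (l / 2) (by positivity), hbound (l ^ 2 / 8) (by positivity)]
      with n h1 h2
    have h3 : (m n : ℝ) * l ≤ 2 := by linarith [(abs_le.1 h1).2]
    refine h2.trans ?_
    nlinarith
  obtain ⟨N, hN⟩ := eventually_atTop.1 hclose
  have hconst : ∀ n, N ≤ n → m n = m N := by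
    intro n hn
    have h1 := abs_le.1 (hN n hn)
    have h2 := abs_le.1 (hN N le_rfl)
    have h3 : (m n : ℝ) < m N + 1 := by
      by_contra! hcon
      nlinarith
    have h4 : (m N : ℝ) < m n + 1 := by
      by_contra! hcon
      nlinarith
    have h3' : m n < m N + 1 := by exact_mod_cast h3
    have h4' : m N < m n + 1 := by exact_mod_cast h4
    omega
  refine ⟨m N, eventually_atTop.2 ⟨N, hconst⟩, ?_⟩
  have hle : ∀ ε : ℝ, 0 < ε → |(m N : ℝ) * l - 1| ≤ m N * ε := by
    intro ε hε
    obtain ⟨n, hn, hnN⟩ := ((hbound ε hε).and (eventually_ge_atTop N)).exists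
    rwa [hconst n hnN] at hn
  have hzero : |(m N : ℝ) * l - 1| ≤ 0 := by
    refine le_of_forall_pos_le_add fun ε hε => ?_
    refine (hle (ε / (m N + 1)) (by positivity)).trans ?_
    rw [zero_add, mul_div_assoc', div_le_iff₀ (by positivity)]
    nlinarith
  have := abs_nonpos_iff.1 hzero
  linarith

/-- The variance profile of a rescaled random multipartite matrix. -/
noncomputable def multipartiteVariance {n m : ℕ} (κ : Fin n → Fin m) (F₁ F₂ : Measure ℝ)
    (i j : Fin n) : ℝ :=
  (if κ i = κ j then variance id F₁ else variance id F₂) / n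

theorem sum_multipartiteVariance {n m : ℕ} (κ : Fin n → Fin m) (F₁ F₂ : Measure ℝ) (i : Fin n) :
    ∑ j, multipartiteVariance κ F₁ F₂ i j =
      variance id F₂ + proportion κ (κ i) * (variance id F₁ - variance id F₂) := by
  have hn : (n : ℝ) ≠ 0 := by
    have := i.pos
    positivity
  have h1 : ∀ j, multipartiteVariance κ F₁ F₂ i j = variance id F₂ / n +
      (if κ j = κ i then (1 : ℝ) else 0) * ((variance id F₁ - variance id F₂) / n) := by
    intro j
    simp only [multipartiteVariance, eq_comm (a := κ j)]
    split_ifs <;> ring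
  simp_rw [h1]
  rw [Finset.sum_add_distrib, ← Finset.sum_mul, Finset.sum_boole, Finset.sum_const,
    Finset.card_univ, Fintype.card_fin, nsmul_eq_mul, proportion]
  field_simp

theorem rescaledCentred_apply {n m : ℕ} (κ : Fin n → Fin m) (F₁ F₂ : Measure ℝ)
    (A : Matrix (Fin n) (Fin n) ℝ) (i j : Fin n) :
    rescaledCentred κ F₁ F₂ A i j = (√(n : ℝ))⁻¹ *
      (A i j - if κ i = κ j then ∫ x, x ∂F₁ else ∫ x, x ∂F₂) := by
  simp only [rescaledCentred, centred, quasiUnit, allOnes, Matrix.smul_apply, Matrix.sub_apply,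
    Matrix.of_apply, smul_eq_mul]
  split_ifs <;> ring

theorem IsRandomMultipartiteMatrix.isWignerType {Ω : Type*} [MeasurableSpace Ω]
    {P : Measure Ω} [IsProbabilityMeasure P] {n m : ℕ} {κ : Fin n → Fin m} {F₁ F₂ : Measure ℝ}
    {K : ℝ} {X : Ω → Matrix (Fin n) (Fin n) ℝ} (hX : IsRandomMultipartiteMatrix P κ F₁ F₂ K X) :
    IsWignerType P (multipartiteVariance κ F₁ F₂) (2 * |K| / √(n : ℝ))
      fun ω => rescaledCentred κ F₁ F₂ (X ω) := by
  -- The entrywise mean. It is bounded by `|K|` like the entry itself, whence the bound `2 * |K|` on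
  -- the centred entries.
  set μ : Fin n → Fin n → ℝ := fun i j => if κ i = κ j then ∫ x, x ∂F₁ else ∫ x, x ∂F₂ with hμ
  have hlaw : ∀ i j, ∃ F : Measure ℝ, P.map (fun ω => X ω i j) = F ∧ μ i j = ∫ x, x ∂F ∧
      multipartiteVariance κ F₁ F₂ i j = variance id F / n := by
    intro i j
    by_cases h : κ i = κ j
    · exact ⟨F₁, hX.law_within i j h, by simp [hμ, h], by simp [multipartiteVariance, h]⟩
    · exact ⟨F₂, hX.law_across i j h, by simp [hμ, h], by simp [multipartiteVariance, h]⟩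
  have hmean : ∀ i j, ∫ ω, X ω i j ∂P = μ i j := by
    intro i j
    obtain ⟨F, hF, hμF, -⟩ := hlaw i j
    rw [hμF, ← hF, integral_map (f := fun x : ℝ => x) (hX.measurable i j).aemeasurable
      measurable_id.aestronglyMeasurable]
  have hint : ∀ i j, Integrable (fun ω => X ω i j) P := fun i j =>
    Integrable.of_bound (hX.measurable i j).aestronglyMeasurable K (hX.bounded i j)
  have hμK : ∀ i j, |μ i j| ≤ |K| := by
    intro i j
    rw [← hmean, ← Real.norm_eq_abs]
    refine (norm_integral_le_of_norm_le_const (C := |K|) ?_).trans (by simp)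
    filter_upwards [hX.bounded i j] with ω hω
    exact hω.trans (le_abs_self K)
  refine ⟨hX.isHermitian_rescaledCentred, fun i j => ?_, ?_, fun i j => ?_, fun i j => ?_,
    fun i j => ?_⟩
  · simp_rw [rescaledCentred_apply]
    exact ((hX.measurable i j).sub_const _).const_mul _
  · simp_rw [rescaledCentred_apply]
    exact hX.indep.comp (fun p y => (√(n : ℝ))⁻¹ * (y - μ p.1.1 p.1.2)) fun p => by fun_prop
  · simp_rw [rescaledCentred_apply]
    rw [integral_const_mul, integral_sub (hint i j) (integrable_const _), hmean]
    simp [hμ]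
  · simp_rw [rescaledCentred_apply, mul_pow]
    rw [integral_const_mul]
    obtain ⟨F, hF, hμF, hvar⟩ := hlaw i j
    have h1 : variance id F = ∫ ω, (X ω i j - μ i j) ^ 2 ∂P := by
      rw [variance_eq_integral measurable_id.aemeasurable, ← hF,
        integral_map (hX.measurable i j).aemeasurable (by fun_prop), hF]
      simp only [id, ← hμF]
    rw [hvar, h1, inv_pow, Real.sq_sqrt (Nat.cast_nonneg n), div_eq_inv_mul]
  · filter_upwards [hX.bounded i j] with ω hω
    rw [rescaledCentred_apply, abs_mul, abs_of_nonneg (by positivity), div_eq_inv_mul]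
    refine mul_le_mul_of_nonneg_left ?_ (by positivity)
    refine (abs_sub _ _).trans ?_
    linarith [hμK i j, le_abs_self K, hω]

theorem tendstoWeaklyInProbability_of_tendsto_proportion {Ω : ℕ → Type*}
    [∀ n, MeasurableSpace (Ω n)] {P : ∀ n, Measure (Ω n)} [∀ n, IsProbabilityMeasure (P n)]
    {m : ℕ → ℕ} {κ : ∀ n, Fin n → Fin (m n)} {F₁ F₂ : Measure ℝ} {K : ℝ}
    {X : ∀ n, Ω n → Matrix (Fin n) (Fin n) ℝ}
    (hX : ∀ n, IsRandomMultipartiteMatrix (P n) (κ n) F₁ F₂ K (X n)) {l v : ℝ}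
    (h : ∀ ε : ℝ, 0 < ε → ∀ᶠ n in atTop, ∀ k, |proportion (κ n) k - l| ≤ ε)
    (hv : v = variance id F₂ + l * (variance id F₁ - variance id F₂)) (hv0 : 0 ≤ v) :
    TendstoWeaklyInProbability P
      (fun n ω => esd ((hX n).isHermitian_rescaledCentred ω)) (semicircleLaw v) := by
  refine tendstoWeaklyInProbability_semicircleLaw (C := 2 * |K|) (by positivity) hv0
    (fun n => (hX n).isWignerType) fun δ hδ => ?_
  set D := variance id F₁ - variance id F₂ with hD
  filter_upwards [h (δ / (|D| + 1)) (by positivity)] with n hn i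
  have h1 : ∑ j, multipartiteVariance (κ n) F₁ F₂ i j - v =
      (proportion (κ n) (κ n i) - l) * D := by
    rw [sum_multipartiteVariance, hv]
    ring
  rw [h1, abs_mul]
  refine (mul_le_mul_of_nonneg_right (hn _) (abs_nonneg D)).trans ?_
  rw [div_mul_eq_mul_div, div_le_iff₀ (by positivity)]
  nlinarith

end Multipartite

end RandomMultipartite

/-! ### The two regimes -/

theorem mainTheorem2 {Ω : ℕ → Type*} [∀ n, MeasurableSpace (Ω n)]
    (P : ∀ n, Measure (Ω n)) [∀ n, IsProbabilityMeasure (P n)]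
    (m : ℕ → ℕ) (hm : ∀ n, 2 ≤ m n) (κ : ∀ n, Fin n → Fin (m n))
    (F₁ F₂ : Measure ℝ) [IsProbabilityMeasure F₁] [IsProbabilityMeasure F₂] (K : ℝ)
    (X : ∀ n, Ω n → Matrix (Fin n) (Fin n) ℝ)
    (hX : ∀ n, RandomMultipartite.IsRandomMultipartiteMatrix (P n) (κ n) F₁ F₂ K (X n)) :
    (RandomMultipartite.AsymptoticallyBalanced κ →
      ∃ M : ℕ, (∀ᶠ n in atTop, m n = M) ∧
        RandomMultipartite.TendstoWeaklyInProbability P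
          (fun n ω => RandomMultipartite.esd ((hX n).isHermitian_rescaledCentred ω))
          (RandomMultipartite.semicircleLaw (RandomMultipartite.deltaSq F₁ F₂ M))) ∧
    (RandomMultipartite.AsymptoticallyNegligible κ →
      RandomMultipartite.TendstoWeaklyInProbability P
        (fun n ω => RandomMultipartite.esd ((hX n).isHermitian_rescaledCentred ω))
        (RandomMultipartite.semicircleLaw (variance id F₂))) := by
  have hv1 : 0 ≤ variance id F₁ := variance_nonneg _ _
  have hv2 : 0 ≤ variance id F₂ := variance_nonneg _ _
  refine ⟨fun h => ?_, fun h => ?_⟩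
  · obtain ⟨l, hl, hlim⟩ := h.exists_tendsto hm
    obtain ⟨M, hM, hMl⟩ := RandomMultipartite.exists_eventually_eq_of_tendsto_proportion hl hlim
    have hMpos : (1 : ℝ) ≤ M := by
      have : M ≠ 0 := by rintro rfl; simp at hMl
      exact_mod_cast Nat.one_le_iff_ne_zero.2 this
    refine ⟨M, hM, RandomMultipartite.tendstoWeaklyInProbability_of_tendsto_proportion hX hlim
      ?_ ?_⟩
    -- With `M * l = 1`, the limiting row sum `σ₂² + l (σ₁² - σ₂²)` is `Δ²`.
    · rw [RandomMultipartite.deltaSq, div_eq_iff (by positivity)]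
      linear_combination (variance id F₂ - variance id F₁) * hMl
    · exact div_nonneg (add_nonneg hv1 (mul_nonneg (by linarith) hv2)) (by positivity)
  -- With `l = 0` the entries inside a part contribute nothing to the limiting row sum, which leaves
  -- `σ₂²`.
  · refine RandomMultipartite.tendstoWeaklyInProbability_of_tendsto_proportion hX (l := 0)
      (fun ε hε => ?_) (by ring) hv2
    have h' : Tendsto (fun n => RandomMultipartite.maxProportion (κ n)) atTop (𝓝 0) := h
    filter_upwards [h'.eventually_le_const hε] with n hn k
    rw [sub_zero, abs_of_nonneg (RandomMultipartite.proportion_nonneg _ _)]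
    exact (RandomMultipartite.proportion_le_maxProportion _ _).trans hn
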